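/- A signature of length $N$ is an $N$-tuple of integers $\lambda=(\lambda_1\ge\dots\ge\lambda_N)$; let $\mathbb{GT}_N$ be the set of these. For $\lambda\in\mathbb{GT}_N$, $\mu\in\mathbb{GT}_{N+1}$ write $\lambda\prec\mu$ if $\mu_1\ge\lambda_1\ge\mu_2\ge\dots\ge\lambda_N\ge\mu_{N+1}$. Let $\mathcal T$ be the set of infinite paths $\tau=(\tau(1),\tau(2),\dots)$ with $\tau(N)\in\mathbb{GT}_N$ and $\tau(N)\prec\tau(N+1)$ for all $N\ge 1$, with the topology whose base consists of the cylinder sets $C_t=\{\tau\in\mathcal T:\tau(1)=t(1),\dots,\tau(N)=t(N)\}$, $t=(t(1)\prec\dots\prec t(N))$ a finite path, and with its Borel $\sigma$-algebra. Let $\operatorname{Dim}_N(\lambda)$ be the number of finite paths $t(1)\prec\dots\prec t(N)=\lambda$ (that is, the dimension of the irreducible representation of $U(N)$ with highest weight $\lambda$). Let $z,w\in\mathbb C$ be non-integers with $\Re(z+w)>-\tfrac12$, and put $$M_N^{z,w}(\lambda)=S_N(z,w)^{-1}\prod_{i=1}^N\left|\frac{1}{\Gamma(z-\lambda_i+i)\,\Gamma(w+N+1+\lambda_i-i)}\right|^2\operatorname{Dim}_N(\lambda)^2,\qquad\lambda\in\mathbb{GT}_N,$$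 where $S_N(z,w)$ is the constant for which $\sum_{\lambda\in\mathbb{GT}_N}M_N^{z,w}(\lambda)=1$. There is exactly one probability measure $\rho_{z,w}$ on $\mathcal T$ (the $(z,w)$-measure) such that $\rho_{z,w}(C_t)=M_N^{z,w}(t(N))/\operatorname{Dim}_N(t(N))$ for every finite path $t=(t(1),\dots,t(N))$. For a signature $\lambda$ let $\lambda^+$ be the Young diagram whose row lengths are the positive coordinates of $\lambda$, and $\lambda^-$ the Young diagram whose row lengths are the absolute values of the negative coordinates. Let $G^{\pm}$ be the set of paths $\tau\in\mathcal T$ for which $\bigcup_N\tau^{\pm}(N)$ is the whole quadrant $\{1,2,\dots\}^2$, and let $\overline G=\mathcal T\setminus(G^+\cup G^-)$ be the set of paths both of whose diagrams are contained in a thick hook, that is, for which neither $\bigcup_N\tau^+(N)$ nor $\bigcup_N\tau^-(N)$ is the whole quadrant. **Theorem 10.** $\rho_{z,w}(\overline G)=0$. -/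

import Mathlib

open MeasureTheory
open scoped ENNReal

namespace GelfandTsetlin

/-- Signatures of length `N` (dominant weights of `U(N)`): `N`-tuples of integers
`s 0 ≥ s 1 ≥ … ≥ s (N-1)`. Indices start at `0`, so `s i` is the coordinate number `i + 1`. -/
def Signature (N : ℕ) : Type := {s : Fin N → ℤ // Antitone s}

instance (N : ℕ) : CoeFun (Signature N) (fun _ => Fin N → ℤ) := ⟨fun s => s.1⟩

/-- The edges of the graph: `mu 0 ≥ la 0 ≥ mu 1 ≥ … ≥ la (N-1) ≥ mu N`. -/
def Interlaces {N : ℕ} (la : Signature N) (mu : Signature (N + 1)) : Prop :=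
  ∀ i : Fin N, la i ≤ mu i.castSucc ∧ mu i.succ ≤ la i

/-- The dual signature `(-s_N, …, -s_1)`. -/
def Signature.dual {N : ℕ} (s : Signature N) : Signature N :=
  ⟨fun i => -s i.rev, fun _ _ h => neg_le_neg (s.2 (Fin.rev_le_rev.mpr h))⟩

/-- The positive Young diagram: its row lengths are the positive coordinates of `s`. -/
def Signature.posDiagram {N : ℕ} (s : Signature N) : YoungDiagram where
  cells := Finset.univ.biUnion fun i : Fin N =>
    (Finset.range (s i).toNat).image fun j => ((i : ℕ), j)
  isLowerSet := by
    rintro ⟨a, b⟩ ⟨c, d⟩ ⟨hca, hdb⟩ h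
    simp only [Finset.coe_biUnion, Finset.coe_univ, Set.mem_univ, Set.iUnion_true, Set.mem_iUnion,
      Finset.coe_image, Finset.coe_range, Set.mem_image, Set.mem_Iio, Prod.mk.injEq] at h ⊢
    obtain ⟨i, j, hj, rfl, rfl⟩ := h
    have hci : c ≤ (i : ℕ) := hca
    have hdj : d ≤ j := hdb
    have hmono : s i ≤ s ⟨c, lt_of_le_of_lt hci i.2⟩ := s.2 (Fin.mk_le_of_le_val hci)
    refine ⟨⟨c, lt_of_le_of_lt hci i.2⟩, d, ?_, rfl, rfl⟩
    exact lt_of_le_of_lt hdj (lt_of_lt_of_le hj (Int.toNat_le_toNat hmono))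

/-- The negative Young diagram: its row lengths are the absolute values of the negative
coordinates of `s`. -/
def Signature.negDiagram {N : ℕ} (s : Signature N) : YoungDiagram := s.dual.posDiagram

theorem Signature.mem_posDiagram {N : ℕ} (s : Signature N) (i j : ℕ) :
    (i, j) ∈ s.posDiagram ↔ ∃ h : i < N, (j : ℤ) < s ⟨i, h⟩ := by
  rw [← YoungDiagram.mem_cells]
  simp only [Signature.posDiagram, Finset.mem_biUnion, Finset.mem_univ, true_and,
    Finset.mem_image, Finset.mem_range, Prod.mk.injEq]
  constructor
  · rintro ⟨a, b, hb, rfl, rfl⟩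
    exact ⟨a.2, by simpa using Int.lt_toNat.mp hb⟩
  · rintro ⟨h, hj⟩
    exact ⟨⟨i, h⟩, j, Int.lt_toNat.mpr hj, rfl, rfl⟩

/-- Infinite paths in the Gelfand-Tsetlin graph. The level `0`, which consists of the single empty
signature joined to every signature of length `1`, is added for convenience only. -/
def GTPath : Type :=
  {t : (N : ℕ) → Signature N // ∀ N, Interlaces (t N) (t (N + 1))}

/-- Finite paths with levels `0, …, N` (again the level `0` carries no information). -/
def FinPath (N : ℕ) : Type :=
  {t : (k : ℕ) → k ≤ N → Signature k //
    ∀ (k : ℕ) (h : k + 1 ≤ N), Interlaces (t k (Nat.le_of_succ_le h)) (t (k + 1) h)}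

/-- The endpoint `τ(N)` of a finite path. -/
def FinPath.endpoint {N : ℕ} (τ : FinPath N) : Signature N := τ.1 N le_rfl

/-- The cylinder set `C_τ` of all infinite paths that begin with the finite path `τ`. -/
def cylinder {N : ℕ} (τ : FinPath N) : Set GTPath :=
  {t | ∀ (k : ℕ) (h : k ≤ N), t.1 k = τ.1 k h}

/-- The topology on paths that is generated by the cylinder sets. -/
instance : TopologicalSpace GTPath :=
  TopologicalSpace.generateFrom {C | ∃ (N : ℕ) (τ : FinPath N), C = cylinder τ}

instance : MeasurableSpace GTPath := borel GTPath

instance : BorelSpace GTPath := ⟨rfl⟩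

/-- `Dim_N(s)`: the number of finite paths terminating at `s`. -/
noncomputable def dim {N : ℕ} (s : Signature N) : ℕ :=
  Nat.card {τ : FinPath N // τ.endpoint = s}

/-- The unnormalized weight
`∏_{i=1}^N |1 / (Γ(z - s_i + i) Γ(w + N + 1 + s_i - i))|² · Dim_N(s)²`. -/
noncomputable def weight (z w : ℂ) {N : ℕ} (s : Signature N) : ℝ≥0∞ :=
  ENNReal.ofReal
    ((∏ i : Fin N,
      ‖1 / (Complex.Gamma (z - (s i : ℂ) + ((i : ℕ) + 1 : ℂ)) *
        Complex.Gamma (w + (N : ℂ) + 1 + (s i : ℂ) - ((i : ℕ) + 1 : ℂ)))‖ ^ 2) *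
      (dim s : ℝ) ^ 2)

/-- The normalization constant `S_N(z,w)`. -/
noncomputable def normalization (z w : ℂ) (N : ℕ) : ℝ≥0∞ := ∑' s : Signature N, weight z w s

/-- The probability `M_N^{z,w}(s)`. -/
noncomputable def coherentSystem (z w : ℂ) {N : ℕ} (s : Signature N) : ℝ≥0∞ :=
  (normalization z w N)⁻¹ * weight z w s

/-- `ρ` is the `(z,w)`-measure: the probability measure on the space of paths with
`ρ(C_τ) = M_N^{z,w}(τ(N)) / Dim_N(τ(N))` for all finite paths `τ = (τ(1), …, τ(N))`. -/
structure IsZWMeasure (z w : ℂ) (ρ : Measure GTPath) : Prop where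
  isProbabilityMeasure : IsProbabilityMeasure ρ
  apply_cylinder : ∀ (N : ℕ) (τ : FinPath N),
    ρ (cylinder τ) = coherentSystem z w τ.endpoint / (dim τ.endpoint : ℝ≥0∞)

/-- The union of the positive Young diagrams along a path. -/
def GTPath.posUnion (t : GTPath) : Set (ℕ × ℕ) := ⋃ N : ℕ, ((t.1 N).posDiagram : Set (ℕ × ℕ))

/-- The union of the negative Young diagrams along a path. -/
def GTPath.negUnion (t : GTPath) : Set (ℕ × ℕ) := ⋃ N : ℕ, ((t.1 N).negDiagram : Set (ℕ × ℕ))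

/-- `G⁺`: the positive Young diagrams exhaust the whole quadrant. -/
def GPlus : Set GTPath := {t | t.posUnion = Set.univ}

/-- `G⁻`: the negative Young diagrams exhaust the whole quadrant. -/
def GMinus : Set GTPath := {t | t.negUnion = Set.univ}

/-- The set of paths both of whose Young diagrams are contained in a thick hook, that is, neither
the positive nor the negative Young diagrams exhaust the whole quadrant. -/
def thickHookPaths : Set GTPath := (GPlus ∪ GMinus)ᶜ

theorem mem_thickHookPaths (t : GTPath) :
    t ∈ thickHookPaths ↔ t.posUnion ≠ Set.univ ∧ t.negUnion ≠ Set.univ := by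
  simp [thickHookPaths, GPlus, GMinus]

end GelfandTsetlin

namespace GelfandTsetlin

/-! ### Sums of determinants -/

theorem hasSum_mul_real {α β : Type*} {f : α → ℝ} {g : β → ℝ} {a b : ℝ} (hf : HasSum f a)
    (hg : HasSum g b) : HasSum (fun x : α × β => f x.1 * g x.2) (a * b) :=
  hf.mul hg (summable_mul_of_summable_norm (f := f) (g := g) hf.summable.abs hg.summable.abs)

theorem hasSum_pi_prod {n : ℕ} (f : Fin n → ℤ → ℝ) (hf : ∀ i, Summable (f i)) :
    HasSum (fun m : Fin n → ℤ => ∏ i, f i (m i)) (∏ i, ∑' k, f i k) := by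
  induction n with
  | zero => simp
  | succ n ih =>
    have h1 := (hf 0).hasSum
    have h2 := ih (fun i => f i.succ) (fun i => hf i.succ)
    have h3 := hasSum_mul_real h1 h2
    rw [← (Fin.consEquiv (fun _ : Fin (n + 1) => ℤ)).hasSum_iff, Fin.prod_univ_succ]
    refine h3.congr_fun ?_
    rintro ⟨a, m⟩
    simp [Fin.prod_univ_succ, Fin.consEquiv]

theorem hasSum_det {n : ℕ} (g : Fin n → Fin n → ℤ → ℝ) (hg : ∀ i j, Summable (g i j)) :
    HasSum (fun m : Fin n → ℤ => (Matrix.of fun i j => g i j (m i)).det)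
      (Matrix.of fun i j => ∑' k, g i j k).det := by
  simp_rw [← Matrix.det_transpose (Matrix.of _), Matrix.det_apply']
  refine hasSum_sum fun σ _ => HasSum.mul_left _ ?_
  simpa using hasSum_pi_prod (fun i => g i (σ i)) (fun i => hg i (σ i))

open Polynomial in
theorem det_eval_polynomials {n : ℕ} (v : Fin n → ℝ) (p : Fin n → ℝ[X])
    (hp : ∀ j, (p j).natDegree ≤ j) :
    (Matrix.of fun i j => (p j).eval (v i)).det =
      (∏ j, (p j).coeff j) * (Matrix.vandermonde v).det := by
  rw [Matrix.eval_matrixOfPolynomials_eq_vandermonde_mul_matrixOfPolynomials v p hp,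
    Matrix.det_mul, mul_comm, Matrix.det_of_isUpperTriangular]
  · simp
  · intro i j hij
    simp only [Matrix.of_apply]
    exact coeff_eq_zero_of_natDegree_lt ((hp j).trans_lt hij)

/-- A determinant whose rows are the successive differences of the rows of another one. -/
theorem det_row_differences {n : ℕ} (A : Fin (n + 1) → Fin (n + 1) → ℝ) :
    (Matrix.of fun i j => A i j - Fin.cases (motive := fun _ => ℝ) 0
      (fun k => A k.castSucc j) i).det = (Matrix.of A).det := by
  symm
  refine Matrix.det_eq_of_forall_row_eq_smul_add_pred (fun _ => 1) ?_ ?_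
  · intro j; simp
  · intro i j; simp

theorem det_of_last_row {n : ℕ} (A : Matrix (Fin (n + 1)) (Fin (n + 1)) ℝ)
    (h : ∀ j : Fin n, A (Fin.last n) j.succ = 0) :
    A.det = (-1) ^ n * A (Fin.last n) 0 *
      (Matrix.of fun i j : Fin n => A i.castSucc j.succ).det := by
  rw [Matrix.det_succ_row A (Fin.last n), Fin.sum_univ_succ]
  rw [Finset.sum_eq_zero (fun j _ => by rw [h]; ring)]
  simp only [Fin.val_last, Fin.val_zero, add_zero]
  congr 2
  ext i j
  simp [Matrix.submatrix_apply]

theorem det_vandermonde_eq_det_differences {n : ℕ} (v : Fin (n + 1) → ℝ) :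
    (Matrix.vandermonde v).det =
      (Matrix.of fun i j : Fin n => v i.succ ^ (j + 1 : ℕ) - v i.castSucc ^ (j + 1 : ℕ)).det := by
  have h := det_row_differences (fun i j : Fin (n + 1) => v i ^ (j : ℕ))
  have h' : (Matrix.vandermonde v) = Matrix.of fun i j : Fin (n + 1) => v i ^ (j : ℕ) := rfl
  rw [h', ← h, Matrix.det_succ_column_zero, Fin.sum_univ_succ,
    Finset.sum_eq_zero (fun i _ => by simp)]
  simp
  congr 1

/-- The strictly increasing integers `i - s i` (indices starting at `0`). -/
def posn {N : ℕ} (s : Signature N) (i : Fin N) : ℤ := (i : ℤ) - s i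

theorem posn_strictMono {N : ℕ} (s : Signature N) : StrictMono (posn s) := by
  intro i j h
  have h1 := s.2 h.le
  have h2 : (i : ℤ) < j := by exact_mod_cast h
  simp only [posn]
  omega

/-- The signature with given strictly increasing shifted coordinates. -/
def ofPosn {N : ℕ} (n : Fin N → ℤ) (hn : StrictMono n) : Signature N :=
  ⟨fun i => (i : ℤ) - n i, by
    intro i j h
    have key : ∀ k : ℕ, ∀ i j : Fin N, (j : ℕ) = i + k → n i + k ≤ n j := by
      intro k
      induction k with
      | zero => intro i j h; rw [Fin.ext (show (i : ℕ) = j by omega)]; simp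
      | succ k ih =>
        intro i j h
        have hlt : (i : ℕ) + k < N := by omega
        have h1 := ih i ⟨i + k, hlt⟩ rfl
        have h2 : n ⟨i + k, hlt⟩ < n j := hn (by rw [Fin.lt_def]; simp; omega)
        push_cast
        omega
    have hij : (i : ℕ) ≤ j := h
    have := key (j - i) i j (by omega)
    simp only
    omega⟩

@[simp] theorem posn_ofPosn {N : ℕ} (n : Fin N → ℤ) (hn : StrictMono n) :
    posn (ofPosn n hn) = n := by
  ext i; simp [posn, ofPosn]

theorem posn_injective {N : ℕ} : Function.Injective (posn (N := N)) := by
  intro s t h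
  apply Subtype.ext
  funext i
  have := congrFun h i
  simp only [posn] at this
  omega

theorem interlaces_iff {N : ℕ} (la : Signature N) (mu : Signature (N + 1)) :
    Interlaces la mu ↔
      ∀ i : Fin N, posn mu i.castSucc ≤ posn la i ∧ posn la i < posn mu i.succ := by
  refine forall_congr' fun i => ?_
  simp only [posn, Fin.val_castSucc, Fin.val_succ]
  push_cast
  constructor <;> rintro ⟨h1, h2⟩ <;> constructor <;> omega

/-- The Vandermonde product of the shifted coordinates. -/
noncomputable def vdm {N : ℕ} (s : Signature N) : ℝ :=
  (Matrix.vandermonde fun i => (posn s i : ℝ)).det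

theorem vdm_pos {N : ℕ} (s : Signature N) : 0 < vdm s := by
  rw [vdm, Matrix.det_vandermonde]
  refine Finset.prod_pos fun i _ => Finset.prod_pos fun j hj => ?_
  rw [sub_pos]
  exact_mod_cast posn_strictMono s (Finset.mem_Ioi.mp hj)

/-! ### The dimension formula -/

theorem hasSum_telescope (F : ℤ → ℝ) {a b : ℤ} (hab : a ≤ b) :
    HasSum (fun k => if a ≤ k ∧ k < b then F (k + 1) - F k else 0) (F b - F a) := by
  induction b, hab using Int.leInduction with
  | base =>
    rw [sub_self]
    convert! hasSum_zero using 2 with k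
    rw [if_neg (by omega)]
  | succ b hab ih =>
    have h := ih.add (hasSum_ite_eq b (F (b + 1) - F b))
    rw [show F (b + 1) - F a = F b - F a + (F (b + 1) - F b) by ring]
    refine h.congr_fun fun k => ?_
    by_cases hk : k = b
    · subst hk; simp [hab]
    · rw [if_neg hk, add_zero]
      exact if_congr (by omega) rfl rfl

theorem strictMono_of_between {N : ℕ} (mu : Signature (N + 1)) (n : Fin N → ℤ)
    (h : ∀ i : Fin N, posn mu i.castSucc ≤ n i ∧ n i < posn mu i.succ) : StrictMono n := by
  intro i j hij
  have h1 : i.succ ≤ j.castSucc := by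
    rw [Fin.le_def]; simp; exact hij
  have := (posn_strictMono mu).monotone h1
  have := h i
  have := h j
  omega

theorem det_zero_of_row {n : ℕ} {A : Matrix (Fin n) (Fin n) ℝ} (i : Fin n) (h : ∀ j, A i j = 0) :
    A.det = 0 := Matrix.det_eq_zero_of_row_eq_zero i h

open Polynomial in
theorem det_pow_differences {N : ℕ} (v : Fin N → ℝ) :
    (Matrix.of fun i j : Fin N => (v i + 1) ^ (j + 1 : ℕ) - v i ^ (j + 1 : ℕ)).det =
      N.factorial * (Matrix.vandermonde v).det := by
  have hc : ∀ j k : ℕ, ((X + 1 : ℝ[X]) ^ (j + 1) - X ^ (j + 1)).coeff k =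
      ((j + 1).choose k : ℝ) - if k = j + 1 then 1 else 0 := by
    intro j k
    rw [coeff_sub, coeff_X_add_one_pow, coeff_X_pow]
  have h := det_eval_polynomials v (fun j : Fin N => (X + 1 : ℝ[X]) ^ (j + 1 : ℕ) - X ^ (j + 1 : ℕ))
    (by
      intro j
      rw [natDegree_le_iff_coeff_eq_zero]
      intro k hk
      rw [hc]
      rcases Nat.lt_or_ge (j + 1 : ℕ) k with h | h
      · rw [Nat.choose_eq_zero_of_lt h, if_neg (by omega)]; simp
      · have : k = (j : ℕ) + 1 := by omega
        rw [this]; simp)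
  simp only [hc] at h
  have hprod : (∏ j : Fin N, ((((j : ℕ) + 1).choose j : ℝ) - if (j : ℕ) = j + 1 then 1 else 0)) =
      N.factorial := by
    rw [← Finset.prod_range_add_one_eq_factorial, Finset.prod_range]
    push_cast
    refine Finset.prod_congr rfl fun j _ => ?_
    rw [if_neg (by omega), Nat.choose_succ_self_right]
    push_cast; ring
  rw [hprod] at h
  rw [← h]
  congr 2
  ext i j
  simp

theorem hasSum_vdm_interlaces {N : ℕ} (mu : Signature (N + 1)) :
    HasSum (fun la : {la : Signature N // Interlaces la mu} => N.factorial * vdm la.1) (vdm mu) := by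
  let P : Fin N → ℤ → Prop := fun i k => posn mu i.castSucc ≤ k ∧ k < posn mu i.succ
  have hP : ∀ i : Fin N, posn mu i.castSucc ≤ posn mu i.succ := fun i =>
    (posn_strictMono mu).monotone Fin.castSucc_lt_succ.le
  have hs : ∀ i j : Fin N, HasSum (fun k : ℤ => if posn mu i.castSucc ≤ k ∧ k < posn mu i.succ then
      (((k + 1 : ℤ) : ℝ) ^ (j + 1 : ℕ) - (k : ℝ) ^ (j + 1 : ℕ)) else 0)
      ((posn mu i.succ : ℝ) ^ (j + 1 : ℕ) - (posn mu i.castSucc : ℝ) ^ (j + 1 : ℕ)) :=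
    fun i j => hasSum_telescope (fun k => (k : ℝ) ^ (j + 1 : ℕ)) (hP i)
  have h := hasSum_det (fun (i j : Fin N) (k : ℤ) =>
    if posn mu i.castSucc ≤ k ∧ k < posn mu i.succ then
      (((k + 1 : ℤ) : ℝ) ^ (j + 1 : ℕ) - (k : ℝ) ^ (j + 1 : ℕ)) else 0)
    (fun i j => (hs i j).summable)
  simp only [(hs _ _).tsum_eq] at h
  rw [← det_vandermonde_eq_det_differences (fun i => (posn mu i : ℝ))] at h
  have hinj : Function.Injective (fun la : {la : Signature N // Interlaces la mu} => posn la.1) :=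
    posn_injective.comp Subtype.val_injective
  rw [← hinj.hasSum_iff] at h
  · refine h.congr_fun fun la => ?_
    rw [vdm, ← det_pow_differences]
    simp only [Function.comp_apply]
    congr 2
    ext i j
    rw [if_pos ((interlaces_iff la.1 mu).mp la.2 i)]
    push_cast
    rfl
  · intro n hn
    by_cases hall : ∀ i, P i (n i)
    · refine absurd ⟨⟨ofPosn n (strictMono_of_between mu n hall), ?_⟩, ?_⟩ hn
      · rw [interlaces_iff]; simpa using hall
      · simp
    · push Not at hall
      obtain ⟨i, hi⟩ := hall
      exact det_zero_of_row i fun j => if_neg hi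

/-- The finite path obtained by forgetting the endpoint. -/
def FinPath.init {N : ℕ} (t : FinPath (N + 1)) : FinPath N :=
  ⟨fun k hk => t.1 k (hk.trans N.le_succ), fun k h => t.2 k (h.trans N.le_succ)⟩

theorem FinPath.interlaces_init {N : ℕ} (t : FinPath (N + 1)) :
    Interlaces t.init.endpoint t.endpoint := t.2 N le_rfl

/-- The finite path obtained by adding an endpoint. -/
def FinPath.snoc {N : ℕ} (t : FinPath N) (mu : Signature (N + 1))
    (h : Interlaces t.endpoint mu) : FinPath (N + 1) :=
  ⟨fun k hk => if hk' : k ≤ N then t.1 k hk' else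
      (show N + 1 = k by omega) ▸ mu, by
    intro k hk
    by_cases hk' : k + 1 ≤ N
    · exact Eq.mpr (congr (congrArg Interlaces (dif_pos (Nat.le_of_succ_le hk'))) (dif_pos hk'))
        (t.2 k hk')
    · obtain rfl : k = N := by omega
      exact Eq.mpr (congr (congrArg Interlaces (dif_pos le_rfl)) (dif_neg hk')) h⟩

@[simp] theorem FinPath.init_snoc {N : ℕ} (t : FinPath N) (mu : Signature (N + 1))
    (h : Interlaces t.endpoint mu) : (t.snoc mu h).init = t := by
  apply Subtype.ext
  funext k hk
  exact dif_pos hk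

@[simp] theorem FinPath.endpoint_snoc {N : ℕ} (t : FinPath N) (mu : Signature (N + 1))
    (h : Interlaces t.endpoint mu) : (t.snoc mu h).endpoint = mu := by
  simp [FinPath.snoc, FinPath.endpoint]

theorem FinPath.ext_init {N : ℕ} {t u : FinPath (N + 1)} (h1 : t.init = u.init)
    (h2 : t.endpoint = u.endpoint) : t = u := by
  apply Subtype.ext
  funext k hk
  rcases Nat.lt_or_ge N k with h | h
  · obtain rfl : k = N + 1 := by omega
    exact h2
  · have := congrArg (fun v : FinPath N => v.1 k h) h1
    exact this

/-- Finite paths with a given endpoint, by their last step. -/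
def pathsEquiv {N : ℕ} (mu : Signature (N + 1)) :
    {t : FinPath (N + 1) // t.endpoint = mu} ≃
      Σ la : {la : Signature N // Interlaces la mu}, {t : FinPath N // t.endpoint = la.1} where
  toFun t := ⟨⟨t.1.init.endpoint, by
    have := t.1.interlaces_init; rwa [t.2] at this⟩, ⟨t.1.init, rfl⟩⟩
  invFun x := ⟨x.2.1.snoc mu (by rw [x.2.2]; exact x.1.2), by simp⟩
  left_inv t := by
    apply Subtype.ext
    apply FinPath.ext_init
    · simp
    · simp [t.2]
  right_inv x := by
    obtain ⟨⟨la, hla⟩, ⟨t, ht⟩⟩ := x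
    obtain rfl : t.endpoint = la := ht
    have h := FinPath.init_snoc t mu hla
    refine Sigma.ext (Subtype.ext (by simp)) ?_
    simp only [FinPath.init_snoc]
    congr!

instance signatureZeroUnique : Unique (Signature 0) where
  default := ⟨fun i => i.elim0, fun i => i.elim0⟩
  uniq _ := Subtype.ext (funext fun i => i.elim0)

instance finPathZeroUnique : Unique (FinPath 0) where
  default := ⟨fun k hk => ⟨fun i => (i.cast (Nat.le_zero.mp hk)).elim0,
    fun i => (i.cast (Nat.le_zero.mp hk)).elim0⟩, fun k h => absurd h (by omega)⟩
  uniq t := by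
    apply Subtype.ext
    funext k hk
    obtain rfl := Nat.le_zero.mp hk
    exact Subsingleton.elim _ _

instance finite_interlaces {N : ℕ} (mu : Signature (N + 1)) :
    Finite {la : Signature N // Interlaces la mu} := by
  have : Finite (Set.Icc (fun i : Fin N => mu i.succ) (fun i => mu i.castSucc)) :=
    Set.finite_Icc _ _
  refine Finite.of_injective (β := Set.Icc (fun i : Fin N => mu i.succ) (fun i => mu i.castSucc))
    (fun la => ⟨la.1.1, fun i => (la.2 i).2, fun i => (la.2 i).1⟩) ?_
  intro a b h
  have h' : a.1.1 = b.1.1 := congrArg (fun x => x.1) h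
  exact Subtype.ext (Subtype.ext h')

instance finite_paths {N : ℕ} (s : Signature N) : Finite {t : FinPath N // t.endpoint = s} := by
  induction N with
  | zero => infer_instance
  | succ N ih => exact Finite.of_equiv _ (pathsEquiv s).symm

theorem dim_succ {N : ℕ} (mu : Signature (N + 1)) :
    dim mu = ∑' la : {la : Signature N // Interlaces la mu}, dim la.1 := by
  have := Fintype.ofFinite {la : Signature N // Interlaces la mu}
  rw [tsum_fintype, dim, Nat.card_congr (pathsEquiv mu), Nat.card_sigma]
  rfl

theorem dim_mul_factorials {N : ℕ} (s : Signature N) :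
    (dim s : ℝ) * (∏ k ∈ Finset.range N, k.factorial : ℕ) = vdm s := by
  induction N with
  | zero =>
    have : dim s = 1 := by
      rw [dim, Nat.card_eq_one_iff_unique]
      exact ⟨inferInstance, ⟨⟨default, Subsingleton.elim _ _⟩⟩⟩
    simp [this, vdm]
  | succ N ih =>
    have := Fintype.ofFinite {la : Signature N // Interlaces la s}
    have h := (hasSum_vdm_interlaces s).tsum_eq
    rw [← h, dim_succ, tsum_fintype, tsum_fintype, Finset.prod_range_succ]
    push_cast
    rw [Finset.sum_mul]
    refine Finset.sum_congr rfl fun la _ => ?_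
    rw [← ih la.1]
    push_cast
    ring

theorem dim_pos {N : ℕ} (s : Signature N) : 0 < dim s := by
  have h := dim_mul_factorials s
  have h2 := vdm_pos s
  rcases Nat.eq_zero_or_pos (dim s) with h0 | h0
  · rw [h0] at h; simp at h; linarith
  · exact h0

/-! ### Asymptotics of the Gamma function -/

theorem gamma_ne_zero_of_not_int {s : ℂ} (hs : ∀ n : ℤ, s ≠ n) : Complex.Gamma s ≠ 0 :=
  Complex.Gamma_ne_zero fun m h => hs (-m) (by rw [h]; push_cast; rfl)

theorem add_int_not_int {s : ℂ} (hs : ∀ n : ℤ, s ≠ n) (k : ℤ) : ∀ n : ℤ, s + k ≠ n := by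
  intro n h
  exact hs (n - k) (by rw [Int.cast_sub, ← h]; ring)

theorem neg_not_int {s : ℂ} (hs : ∀ n : ℤ, s ≠ n) : ∀ n : ℤ, -s ≠ n := by
  intro n h
  exact hs (-n) (by rw [Int.cast_neg, ← h]; ring)

theorem gamma_add_nat {s : ℂ} (hs : ∀ n : ℤ, s ≠ n) (n : ℕ) :
    Complex.Gamma (s + n) = (∏ j ∈ Finset.range n, (s + j)) * Complex.Gamma s := by
  induction n with
  | zero => simp
  | succ n ih =>
    have h0 : s + n ≠ 0 := by
      have := add_int_not_int hs n 0
      simpa using this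
    rw [Finset.prod_range_succ, Nat.cast_succ, ← add_assoc, Complex.Gamma_add_one _ h0, ih]
    ring

theorem gamma_bounds {s : ℂ} (hs : ∀ n : ℤ, s ≠ n) : ∃ c C : ℝ, 0 < c ∧ 0 < C ∧
    ∀ n : ℕ, 1 ≤ n → c * ((n : ℝ) ^ s.re * n.factorial) ≤ ‖Complex.Gamma (s + n + 1)‖ ∧
      ‖Complex.Gamma (s + n + 1)‖ ≤ C * ((n : ℝ) ^ s.re * n.factorial) := by
  have hG := gamma_ne_zero_of_not_int hs
  have h1 : Filter.Tendsto (fun n => ‖Complex.GammaSeq s n‖ / ‖Complex.Gamma s‖) Filter.atTop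
      (nhds 1) := by
    have := (Complex.GammaSeq_tendsto_Gamma s).norm.div_const ‖Complex.Gamma s‖
    rwa [div_self (norm_ne_zero_iff.mpr hG)] at this
  have h2 := h1.inv₀ one_ne_zero
  rw [inv_one] at h2
  obtain ⟨A, hA⟩ := h1.bddAbove_range
  obtain ⟨B, hB⟩ := h2.bddAbove_range
  have key : ∀ n : ℕ, 1 ≤ n → ‖Complex.GammaSeq s n‖ * ‖Complex.Gamma (s + n + 1)‖ =
      (n : ℝ) ^ s.re * n.factorial * ‖Complex.Gamma s‖ := by
    intro n hn
    have hP : (∏ j ∈ Finset.range (n + 1), (s + j)) ≠ 0 := by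
      refine Finset.prod_ne_zero_iff.mpr fun j _ => ?_
      have := add_int_not_int hs j 0
      simpa using this
    have e : Complex.Gamma (s + n + 1) = (∏ j ∈ Finset.range (n + 1), (s + j)) * Complex.Gamma s := by
      rw [← gamma_add_nat hs]; push_cast; ring_nf
    rw [← norm_mul, e, Complex.GammaSeq, ← mul_assoc, div_mul_cancel₀ _ hP, norm_mul, norm_mul,
      Complex.norm_natCast_cpow_of_pos hn, Complex.norm_natCast]
  have hpos : ∀ n : ℕ, 1 ≤ n → 0 < ‖Complex.GammaSeq s n‖ := by
    intro n hn
    have h := key n hn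
    have : 0 < (n : ℝ) ^ s.re * n.factorial * ‖Complex.Gamma s‖ := by positivity
    rw [← h] at this
    exact pos_of_mul_pos_left this (norm_nonneg _)
  have hgs : 0 < ‖Complex.Gamma s‖ := by positivity
  have hA0 : 0 < A := lt_of_lt_of_le (div_pos (hpos 1 le_rfl) hgs) (hA ⟨1, rfl⟩)
  have hB0 : 0 < B := lt_of_lt_of_le (inv_pos.mpr (div_pos (hpos 1 le_rfl) hgs)) (hB ⟨1, rfl⟩)
  refine ⟨A⁻¹, B, inv_pos.mpr hA0, hB0, fun n hn => ⟨?_, ?_⟩⟩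
  · have h := key n hn
    have ha : ‖Complex.GammaSeq s n‖ / ‖Complex.Gamma s‖ ≤ A := hA ⟨n, rfl⟩
    rw [inv_mul_le_iff₀ hA0]
    rw [div_le_iff₀ hgs] at ha
    have := mul_le_mul_of_nonneg_right ha (norm_nonneg (Complex.Gamma (s + n + 1)))
    rw [h] at this
    exact le_of_mul_le_mul_right (by linarith) hgs
  · have h := key n hn
    have hb : (‖Complex.GammaSeq s n‖ / ‖Complex.Gamma s‖)⁻¹ ≤ B := hB ⟨n, rfl⟩
    rw [inv_div, div_le_iff₀ (hpos n hn)] at hb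
    have := mul_le_mul_of_nonneg_right hb (norm_nonneg (Complex.Gamma (s + n + 1)))
    rw [mul_assoc, h] at this
    exact le_of_mul_le_mul_right (by linarith) hgs

theorem norm_sin_pi_pos {s : ℂ} (hs : ∀ n : ℤ, s ≠ n) : 0 < ‖Complex.sin (Real.pi * s)‖ := by
  rw [norm_pos_iff, Complex.sin_ne_zero_iff]
  intro k hk
  rw [mul_comm] at hk
  exact hs k (mul_right_cancel₀ (by exact_mod_cast Real.pi_ne_zero) hk)

/-- The reciprocal of `Γ` to the left of the origin, by the reflection formula. -/
theorem norm_inv_gamma_sub_nat {s : ℂ} (hs : ∀ n : ℤ, s ≠ n) (n : ℕ) :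
    ‖Complex.Gamma (s - n)‖⁻¹ =
      ‖Complex.sin (Real.pi * s)‖ / Real.pi * ‖Complex.Gamma (-s + n + 1)‖ := by
  have h := Complex.Gamma_mul_Gamma_one_sub (s - n)
  have hne := gamma_ne_zero_of_not_int (add_int_not_int hs (-n))
  have hsin : ‖Complex.sin (Real.pi * (s - n))‖ = ‖Complex.sin (Real.pi * s)‖ := by
    rw [mul_sub, mul_comm (Real.pi : ℂ) (n : ℂ), Complex.sin_antiperiodic.sub_nat_mul_eq n]
    simp
  have hs0 := (norm_sin_pi_pos hs).ne'
  have h' := congrArg norm h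
  rw [norm_mul, norm_div, hsin, Complex.norm_real, Real.norm_of_nonneg Real.pi_pos.le] at h'
  have e : (1 : ℂ) - (s - n) = -s + n + 1 := by ring
  rw [e] at h'
  have hne' : ‖Complex.Gamma (s - n)‖ ≠ 0 := by
    rw [norm_ne_zero_iff]; simpa [sub_eq_add_neg] using hne
  have hp := Real.pi_pos.ne'
  rw [inv_eq_iff_eq_inv, eq_comm, inv_eq_iff_eq_inv, eq_comm, inv_eq_of_mul_eq_one_right]
  calc _ = ‖Complex.sin (Real.pi * s)‖ / Real.pi *
        (‖Complex.Gamma (s - n)‖ * ‖Complex.Gamma (-s + n + 1)‖) := by ring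
    _ = 1 := by rw [h']; field_simp

/-! ### The one-particle weight -/

/-- The weight of a particle at `n`, where particles sit at the shifted coordinates. -/
noncomputable def particleWeight (z w : ℂ) (N : ℕ) (n : ℤ) : ℝ :=
  ‖1 / (Complex.Gamma (z + 1 + n) * Complex.Gamma (w + N - n))‖ ^ 2

theorem particleWeight_pos {z w : ℂ} (hz : ∀ n : ℤ, z ≠ n) (hw : ∀ n : ℤ, w ≠ n) (N : ℕ) (n : ℤ) :
    0 < particleWeight z w N n := by
  have h1 := gamma_ne_zero_of_not_int (add_int_not_int hz (1 + n))
  have h2 := gamma_ne_zero_of_not_int (add_int_not_int hw (N - n))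
  have e1 : z + 1 + n = z + ((1 + n : ℤ) : ℂ) := by push_cast; ring
  have e2 : w + N - n = w + ((N - n : ℤ) : ℂ) := by push_cast; ring
  rw [particleWeight, e1, e2]
  exact pow_pos (norm_pos_iff.mpr (one_div_ne_zero (mul_ne_zero h1 h2))) 2

theorem particleWeight_succ {z w : ℂ} (hw : ∀ n : ℤ, w ≠ n) (N : ℕ) (n : ℤ) :
    particleWeight z w N n = particleWeight z w (N + 1) n * ‖w + N - n‖ ^ 2 := by
  have h0 : w + N - n ≠ 0 := by
    have := add_int_not_int hw (N - n) 0
    push_cast at this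
    rwa [← add_sub_assoc] at this
  have e : w + (N + 1 : ℕ) - n = (w + N - n) + 1 := by push_cast; ring
  rw [particleWeight, particleWeight, e, Complex.Gamma_add_one _ h0, ← mul_pow, ← norm_mul]
  congr 2
  by_cases h : Complex.Gamma (z + 1 + n) = 0
  · simp [h]
  by_cases h' : Complex.Gamma (w + N - n) = 0
  · simp [h']
  field_simp

theorem particleWeight_succ_pred {z w : ℂ} (hz : ∀ n : ℤ, z ≠ n) (N : ℕ) (n : ℤ) :
    particleWeight z w N (n - 1) = particleWeight z w (N + 1) n * ‖z + n‖ ^ 2 := by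
  have h0 : z + n ≠ 0 := by
    have := add_int_not_int hz n 0
    simpa using this
  have e : w + (N : ℕ) - ((n - 1 : ℤ) : ℂ) = w + (N + 1 : ℕ) - n := by push_cast; ring
  have e' : z + 1 + ((n - 1 : ℤ) : ℂ) = z + n := by push_cast; ring
  have e'' : z + 1 + n = z + n + 1 := by ring
  rw [particleWeight, particleWeight, e, e', e'', Complex.Gamma_add_one _ h0, ← mul_pow, ← norm_mul]
  congr 2
  by_cases h : Complex.Gamma (z + n) = 0
  · simp [h]
  by_cases h' : Complex.Gamma (w + (N + 1 : ℕ) - n) = 0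
  · rw [h']; simp
  field_simp

theorem particleWeight_reflect (z w : ℂ) (N : ℕ) (n : ℤ) :
    particleWeight z w (N + 1) n = particleWeight w z (N + 1) (N - n) := by
  have e : z + 1 + (n : ℂ) = z + (N + 1 : ℕ) - ((N - n : ℤ) : ℂ) := by push_cast; ring
  have e' : w + (N + 1 : ℕ) - (n : ℂ) = w + 1 + ((N - n : ℤ) : ℂ) := by push_cast; ring
  rw [particleWeight, particleWeight, ← e, ← e', mul_comm]

theorem particleWeight_le {z w : ℂ} (hz : ∀ n : ℤ, z ≠ n) (hw : ∀ n : ℤ, w ≠ n) (N : ℕ) :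
    ∃ C : ℝ, ∀ n : ℕ, 1 ≤ n →
      particleWeight z w (N + 1) n ≤ C * (n : ℝ) ^ (-2 * (z + w).re - 2 * N - 2) := by
  obtain ⟨c, _, hc, _, hzb⟩ := gamma_bounds hz
  have hw' := add_int_not_int hw (N + 1)
  obtain ⟨_, C, _, hC, hwb⟩ := gamma_bounds (neg_not_int hw')
  set s : ℂ := w + ((N + 1 : ℤ) : ℂ) with hs
  set A := ‖Complex.sin (Real.pi * s)‖ / Real.pi
  refine ⟨(c⁻¹ * A * C) ^ 2, fun n hn => ?_⟩
  have hn0 : (0 : ℝ) < n := by exact_mod_cast hn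
  have hA : 0 ≤ A := by positivity
  have e1 : z + 1 + ((n : ℤ) : ℂ) = z + n + 1 := by push_cast; ring
  have e2 : w + (N + 1 : ℕ) - ((n : ℤ) : ℂ) = s - n := by rw [hs]; push_cast; ring
  have h1 := (hzb n hn).1
  have h2 := (hwb n hn).2
  have hf : (0 : ℝ) < n.factorial := by positivity
  have hre : (n : ℝ) ^ (-2 * (z + w).re - 2 * N - 2) = (((n : ℝ) ^ z.re)⁻¹ * (n : ℝ) ^ (-s).re) ^ 2 := by
    rw [← Real.rpow_neg hn0.le, ← Real.rpow_add hn0, ← Real.rpow_natCast, ← Real.rpow_mul hn0.le]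
    congr 1
    rw [hs]; simp; ring
  rw [particleWeight, e1, e2, hre, ← mul_pow]
  refine pow_le_pow_left₀ (norm_nonneg _) ?_ 2
  rw [norm_div, norm_one, norm_mul, one_div, mul_inv, norm_inv_gamma_sub_nat hw' n]
  calc ‖Complex.Gamma (z + n + 1)‖⁻¹ * (A * ‖Complex.Gamma (-s + n + 1)‖)
      ≤ (c * ((n : ℝ) ^ z.re * n.factorial))⁻¹ * (A * (C * ((n : ℝ) ^ (-s).re * n.factorial))) := by
        gcongr
    _ = c⁻¹ * A * C * (((n : ℝ) ^ z.re)⁻¹ * (n : ℝ) ^ (-s).re) := by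
        field_simp

theorem summable_nat_particleWeight {z w : ℂ} (hz : ∀ n : ℤ, z ≠ n) (hw : ∀ n : ℤ, w ≠ n)
    (hzw : -(1 / 2 : ℝ) < (z + w).re) {N j : ℕ} (hj : j ≤ N) :
    Summable fun n : ℕ => particleWeight z w (N + 1) n * (n : ℝ) ^ j := by
  obtain ⟨C, hC⟩ := particleWeight_le hz hw N
  have hs : Summable fun n : ℕ => C * (n : ℝ) ^ (-2 * (z + w).re - 2 * N - 2 + j) := by
    refine Summable.mul_left _ (Real.summable_nat_rpow.mpr ?_)
    have : (j : ℝ) ≤ N := by exact_mod_cast hj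
    have : (0 : ℝ) ≤ N := by positivity
    linarith
  rw [← summable_nat_add_iff 1] at hs ⊢
  refine hs.of_nonneg_of_le (fun n => by unfold particleWeight; positivity) fun n => ?_
  have h := hC (n + 1) (by omega)
  have hn0 : (0 : ℝ) < (n + 1 : ℕ) := by positivity
  rw [Real.rpow_add hn0, Real.rpow_natCast, ← mul_assoc]
  gcongr

theorem summable_particleWeight {z w : ℂ} (hz : ∀ n : ℤ, z ≠ n) (hw : ∀ n : ℤ, w ≠ n)
    (hzw : -(1 / 2 : ℝ) < (z + w).re) {N j : ℕ} (hj : j ≤ N) :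
    Summable fun n : ℤ => particleWeight z w (N + 1) n * (n : ℝ) ^ j := by
  refine Summable.of_nat_of_neg (by simpa using summable_nat_particleWeight hz hw hzw hj) ?_
  have h := summable_nat_particleWeight hw hz (by rwa [add_comm]) hj
  rw [← summable_nat_add_iff N] at h
  refine Summable.of_norm_bounded h fun n => ?_
  rw [particleWeight_reflect, Real.norm_eq_abs, abs_mul, abs_pow,
    abs_of_nonneg (by unfold particleWeight; positivity)]
  have e : (N : ℤ) - -(n : ℤ) = ((n + N : ℕ) : ℤ) := by push_cast; ring
  rw [e]
  refine mul_le_mul_of_nonneg_left ?_ (by unfold particleWeight; positivity)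
  refine pow_le_pow_left₀ (abs_nonneg _) ?_ j
  push_cast
  rw [abs_neg, abs_of_nonneg (by positivity)]
  linarith [(Nat.cast_nonneg N : (0 : ℝ) ≤ N)]

/-! ### Coherence of the weights -/

theorem hasSum_sub_pred {H : ℤ → ℝ} (hH : Summable H) : HasSum (fun k => H k - H (k - 1)) 0 := by
  have h1 := hH.hasSum
  have h2 := (Equiv.subRight (1 : ℤ)).hasSum_iff.mpr h1
  simpa using h1.sub h2

theorem hasSum_le_sub_pred {H : ℤ → ℝ} (hH : Summable H) (x : ℤ) :
    HasSum (fun k => if k ≤ x then H k - H (k - 1) else 0) (H x) := by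
  have h1 := hasSum_sub_pred (hH.indicator {k | k ≤ x})
  have h2 := h1.add (hasSum_ite_eq (x + 1) (H x))
  rw [zero_add] at h2
  refine h2.congr_fun fun k => ?_
  simp only [Set.indicator_apply, Set.mem_ofPred_eq]
  rcases lt_trichotomy k (x + 1) with h | h | h
  · rw [if_pos (by omega), if_pos (by omega), if_pos (by omega), if_neg (by omega), add_zero]
  · subst h
    simp
  · rw [if_neg (by omega), if_neg (by omega), if_neg (by omega), if_neg (by omega)]
    simp

open Polynomial in
/-- The polynomial `‖w + N - m‖² m ^ d - ‖z + m‖² (m - 1) ^ d` in `m`. -/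
noncomputable def stepPoly (z w : ℂ) (N d : ℕ) : ℝ[X] :=
  X ^ 2 * (X ^ d - (X - C 1) ^ d) - C (2 * (w.re + N)) * X ^ (d + 1)
    + C (‖w + N‖ ^ 2) * X ^ d - C (2 * z.re) * (X * (X - C 1) ^ d) - C (‖z‖ ^ 2) * (X - C 1) ^ d

open Polynomial in
theorem stepPoly_eval (z w : ℂ) (N d : ℕ) (m : ℤ) :
    (stepPoly z w N d).eval (m : ℝ) =
      ‖w + N - m‖ ^ 2 * (m : ℝ) ^ d - ‖z + m‖ ^ 2 * ((m - 1 : ℤ) : ℝ) ^ d := by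
  simp only [stepPoly, eval_add, eval_sub, eval_mul, eval_pow, eval_X, eval_C,
    ← Complex.normSq_eq_norm_sq, Complex.normSq_apply, Complex.add_re, Complex.add_im,
    Complex.sub_re, Complex.sub_im, Complex.natCast_re, Complex.natCast_im, Complex.intCast_re,
    Complex.intCast_im]
  push_cast
  ring

open Polynomial in
theorem coeff_X_sub_one_pow (n k : ℕ) :
    ((X - C 1 : ℝ[X]) ^ n).coeff k = (-1) ^ (n - k) * (n.choose k : ℝ) := by
  rw [sub_eq_add_neg, ← C_neg, coeff_X_add_C_pow]

open Polynomial in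
theorem stepPoly_coeff (z w : ℂ) (N d : ℕ) :
    (stepPoly z w N d).coeff (d + 1) = -(2 * (z + w).re + 2 * N - d) := by
  rcases d with _ | e
  · simp only [stepPoly, pow_zero, sub_self, mul_zero, mul_one, coeff_sub, coeff_add, coeff_C_mul,
      coeff_C, coeff_X, coeff_zero, zero_add, pow_one]
    simp
    ring
  · have e1 : (X ^ 2 * (X ^ (e + 1) - (X - C 1) ^ (e + 1)) : ℝ[X]).coeff (e + 1 + 1) = e + 1 := by
      rw [coeff_X_pow_mul, coeff_sub, coeff_X_pow, coeff_X_sub_one_pow]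
      simp
    have e2 : (X * (X - C 1) ^ (e + 1) : ℝ[X]).coeff (e + 1 + 1) = 1 := by
      rw [coeff_X_mul, coeff_X_sub_one_pow]; simp
    have e3 : ((X - C 1) ^ (e + 1) : ℝ[X]).coeff (e + 1 + 1) = 0 := by
      rw [coeff_X_sub_one_pow]; simp
    simp only [stepPoly, coeff_sub, coeff_add, coeff_C_mul, e1, e2, e3, coeff_X_pow]
    simp
    ring

open Polynomial in
theorem stepPoly_natDegree (z w : ℂ) (N d : ℕ) : (stepPoly z w N d).natDegree ≤ d + 1 := by
  rw [natDegree_le_iff_coeff_eq_zero]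
  intro k hk
  obtain ⟨k, rfl⟩ : ∃ l, k = l + 2 := ⟨k - 2, by omega⟩
  have hkd : d ≤ k := by omega
  have e0 : (((X : ℝ[X]) - C 1) ^ d).natDegree = d := by
    rw [natDegree_pow, natDegree_X_sub_C, mul_one]
  have e1 : (X ^ 2 * (X ^ d - (X - C 1) ^ d) : ℝ[X]).coeff (k + 2) = 0 := by
    rw [coeff_X_pow_mul, coeff_sub, coeff_X_pow, coeff_X_sub_one_pow]
    rcases hkd.eq_or_lt with h | h
    · subst h; simp
    · rw [if_neg (by omega), Nat.choose_eq_zero_of_lt h]; simp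
  have e2 : (X * (X - C 1) ^ d : ℝ[X]).coeff (k + 2) = 0 := by
    rw [show k + 2 = (k + 1) + 1 by ring, coeff_X_mul]
    exact coeff_eq_zero_of_natDegree_lt (by omega)
  have e3 : ((X - C 1) ^ d : ℝ[X]).coeff (k + 2) = 0 :=
    coeff_eq_zero_of_natDegree_lt (by omega)
  simp only [stepPoly, coeff_sub, coeff_add, coeff_C_mul, e1, e2, e3, coeff_X_pow]
  rw [if_neg (by omega), if_neg (by omega)]
  simp

open Polynomial in
/-- The polynomials `1` and `stepPoly`, of degrees `0, …, N`. -/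
noncomputable def columnPoly (z w : ℂ) (N : ℕ) : Fin (N + 1) → ℝ[X] :=
  Fin.cases 1 fun d => stepPoly z w N d

theorem columnPoly_natDegree (z w : ℂ) (N : ℕ) (j : Fin (N + 1)) :
    (columnPoly z w N j).natDegree ≤ j := by
  refine Fin.cases ?_ (fun d => ?_) j
  · simp [columnPoly]
  · simpa [columnPoly] using stepPoly_natDegree z w N d

theorem summable_particleWeight_poly {z w : ℂ} (hz : ∀ n : ℤ, z ≠ n) (hw : ∀ n : ℤ, w ≠ n)
    (hzw : -(1 / 2 : ℝ) < (z + w).re) {N : ℕ} {p : Polynomial ℝ} (hp : p.natDegree ≤ N) :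
    Summable fun n : ℤ => particleWeight z w (N + 1) n * p.eval (n : ℝ) := by
  simp_rw [Polynomial.eval_eq_sum_range, Finset.mul_sum]
  refine summable_sum fun j hj => ?_
  have := (summable_particleWeight hz hw hzw (N := N) (j := j)
    (by rw [Finset.mem_range] at hj; omega)).mul_left (p.coeff j)
  refine this.congr fun n => ?_
  ring

/-- The indicator of the half-line `k ≤ posn la i`, or of the whole line if `i` is the last
index. -/
noncomputable def halfLine {N : ℕ} (la : Signature N) (i : Fin (N + 1)) (k : ℤ) : ℝ :=
  if ∀ l : Fin N, i ≤ l.castSucc → k ≤ posn la l then 1 else 0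

theorem halfLine_last {N : ℕ} (la : Signature N) (k : ℤ) : halfLine la (Fin.last N) k = 1 :=
  if_pos fun l hl => absurd hl (not_le.mpr l.castSucc_lt_last)

theorem halfLine_castSucc {N : ℕ} (la : Signature N) (l : Fin N) (k : ℤ) :
    halfLine la l.castSucc k = if k ≤ posn la l then 1 else 0 := by
  refine if_congr ⟨fun h => h l le_rfl, fun h m hm => h.trans ?_⟩ rfl rfl
  exact (posn_strictMono la).monotone (Fin.castSucc_le_castSucc_iff.mp hm)

/-- The indicator of the interval between two neighbouring shifted coordinates. -/
noncomputable def gapIndicator {N : ℕ} (la : Signature N) (i : Fin (N + 1)) (k : ℤ) : ℝ :=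
  halfLine la i k - Fin.cases (motive := fun _ => ℝ) 0 (fun l => halfLine la l.castSucc k) i

theorem gapIndicator_of_interlaces {N : ℕ} {la : Signature N} {mu : Signature (N + 1)}
    (h : Interlaces la mu) (i : Fin (N + 1)) : gapIndicator la i (posn mu i) = 1 := by
  rw [interlaces_iff] at h
  have h1 : halfLine la i (posn mu i) = 1 :=
    if_pos fun l hl => ((posn_strictMono mu).monotone hl).trans (h l).1
  rw [gapIndicator, h1]
  refine Fin.cases ?_ (fun l => ?_) i
  · simp
  · simp [halfLine_castSucc, (h l).2]

theorem gapIndicator_castSucc_eq_zero {N : ℕ} {la : Signature N} {l : Fin N} {k : ℤ}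
    (h : posn la l < k) : gapIndicator la l.castSucc k = 0 := by
  rw [gapIndicator, halfLine_castSucc, if_neg (not_le.mpr h), zero_sub, neg_eq_zero]
  rcases Fin.eq_zero_or_eq_succ l.castSucc with h0 | ⟨m, hm⟩
  · rw [h0]; rfl
  · rw [hm]
    simp only [Fin.cases_succ]
    rw [halfLine_castSucc, if_neg]
    have : posn la m ≤ posn la l := (posn_strictMono la).monotone (by
      have := congrArg Fin.val hm
      rw [Fin.le_def]
      simp at this
      omega)
    omega

theorem gapIndicator_succ_eq_zero {N : ℕ} {la : Signature N} {l : Fin N} {k : ℤ}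
    (h : k ≤ posn la l) : gapIndicator la l.succ k = 0 := by
  have h1 : halfLine la l.succ k = 1 :=
    if_pos fun m hm => h.trans ((posn_strictMono la).monotone (by
      rw [Fin.le_def] at hm ⊢
      simp at hm
      omega))
  rw [gapIndicator, h1, Fin.cases_succ, halfLine_castSucc, if_pos h, sub_self]

theorem summable_halfLine_mul {N : ℕ} (la : Signature N) (i : Fin (N + 1)) {f : ℤ → ℝ}
    (hf : Summable f) : Summable fun k => halfLine la i k * f k := by
  refine (hf.indicator {k | ∀ l : Fin N, i ≤ l.castSucc → k ≤ posn la l}).congr fun k => ?_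
  simp [Set.indicator_apply, halfLine]

theorem hasSum_gapIndicator_mul {N : ℕ} (la : Signature N) (i : Fin (N + 1)) {f : ℤ → ℝ}
    (hf : Summable f) : HasSum (fun k => gapIndicator la i k * f k)
      (∑' k, halfLine la i k * f k - Fin.cases (motive := fun _ => ℝ) 0
        (fun l => ∑' k, halfLine la l.castSucc k * f k) i) := by
  have h1 := (summable_halfLine_mul la i hf).hasSum
  have h2 : HasSum (fun k => (Fin.cases (motive := fun _ => ℝ) 0
      (fun l => halfLine la l.castSucc k) i) * f k) (Fin.cases (motive := fun _ => ℝ) 0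
        (fun l => ∑' k, halfLine la l.castSucc k * f k) i) := by
    refine Fin.cases ?_ (fun l => ?_) i
    · simp
    · simpa using (summable_halfLine_mul la l.castSucc hf).hasSum
  refine (h1.sub h2).congr_fun fun k => ?_
  rw [gapIndicator, sub_mul]

theorem particleWeight_mul_stepPoly {z w : ℂ} (hz : ∀ n : ℤ, z ≠ n) (hw : ∀ n : ℤ, w ≠ n)
    (N d : ℕ) (k : ℤ) :
    particleWeight z w (N + 1) k * (stepPoly z w N d).eval (k : ℝ) =
      particleWeight z w N k * (k : ℝ) ^ d -
        particleWeight z w N (k - 1) * ((k - 1 : ℤ) : ℝ) ^ d := by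
  rw [stepPoly_eval, particleWeight_succ hw N k, particleWeight_succ_pred hz N k]
  ring

theorem coherence_pos {z w : ℂ} (hzw : -(1 / 2 : ℝ) < (z + w).re) {N : ℕ} (d : Fin N) :
    0 < 2 * (z + w).re + 2 * N - (d : ℕ) := by
  have h1 : ((d : ℕ) : ℝ) + 1 ≤ N := by exact_mod_cast d.2
  have h2 : (0 : ℝ) ≤ (d : ℕ) := by positivity
  linarith

theorem prod_columnPoly_coeff (z w : ℂ) (N : ℕ) :
    ∏ j : Fin (N + 1), (columnPoly z w N j).coeff j =
      (-1) ^ N * ∏ d : Fin N, (2 * (z + w).re + 2 * N - (d : ℕ)) := by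
  rw [Fin.prod_univ_succ]
  simp only [columnPoly, Fin.cases_zero, Fin.cases_succ, Fin.val_zero, Fin.val_succ, stepPoly_coeff]
  rw [Finset.prod_neg]
  simp

theorem det_partial_sums {z w : ℂ} (hz : ∀ n : ℤ, z ≠ n) (hw : ∀ n : ℤ, w ≠ n)
    (hzw : -(1 / 2 : ℝ) < (z + w).re) {N : ℕ} (la : Signature N) :
    (Matrix.of fun i j : Fin (N + 1) => ∑' k : ℤ, halfLine la i k *
      (particleWeight z w (N + 1) k * (columnPoly z w N j).eval (k : ℝ))).det =
    (-1) ^ N * (∑' k, particleWeight z w (N + 1) k) *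
      ((∏ i, particleWeight z w N (posn la i)) * vdm la) := by
  have hH : ∀ d : Fin N, Summable fun k : ℤ => particleWeight z w N k * (k : ℝ) ^ (d : ℕ) := by
    intro d
    obtain ⟨M, rfl⟩ : ∃ M, N = M + 1 := ⟨N - 1, by have := d.2; omega⟩
    exact summable_particleWeight hz hw hzw (by have := d.2; omega)
  rw [det_of_last_row]
  · congr 1
    · congr 1
      simp [halfLine_last, columnPoly]
    · rw [vdm, ← Matrix.det_mul_column]
      congr 1
      ext l d
      simp only [Matrix.of_apply, Matrix.vandermonde_apply]
      rw [← (hasSum_le_sub_pred (hH d) (posn la l)).tsum_eq]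
      refine tsum_congr fun k => ?_
      simp only [columnPoly, Fin.cases_succ]
      rw [particleWeight_mul_stepPoly hz hw, halfLine_castSucc]
      simp
  · intro d
    rw [Matrix.of_apply, ← (hasSum_sub_pred (hH d)).tsum_eq]
    refine tsum_congr fun k => ?_
    simp only [columnPoly, Fin.cases_succ]
    rw [particleWeight_mul_stepPoly hz hw, halfLine_last, one_mul]

/-- The factor in the coherence relation between the levels `N` and `N + 1`. -/
noncomputable def coherenceFactor (z w : ℂ) (N : ℕ) : ℝ :=
  (∑' k, particleWeight z w (N + 1) k) / ∏ d : Fin N, (2 * (z + w).re + 2 * N - (d : ℕ))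

theorem coherenceFactor_pos {z w : ℂ} (hz : ∀ n : ℤ, z ≠ n) (hw : ∀ n : ℤ, w ≠ n)
    (hzw : -(1 / 2 : ℝ) < (z + w).re) (N : ℕ) : 0 < coherenceFactor z w N := by
  refine div_pos ?_ (Finset.prod_pos fun d _ => coherence_pos hzw d)
  have hs := summable_particleWeight hz hw hzw (Nat.zero_le N)
  simp only [pow_zero, mul_one] at hs
  exact hs.tsum_pos (fun k => (particleWeight_pos hz hw _ k).le) 0 (particleWeight_pos hz hw _ 0)

theorem hasSum_interlaces {z w : ℂ} (hz : ∀ n : ℤ, z ≠ n) (hw : ∀ n : ℤ, w ≠ n)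
    (hzw : -(1 / 2 : ℝ) < (z + w).re) {N : ℕ} (la : Signature N) :
    HasSum (fun mu : {mu : Signature (N + 1) // Interlaces la mu} =>
        (∏ i, particleWeight z w (N + 1) (posn mu.1 i)) * vdm mu.1)
      (coherenceFactor z w N * ((∏ i, particleWeight z w N (posn la i)) * vdm la)) := by
  have hf : ∀ j : Fin (N + 1), Summable fun k : ℤ =>
      particleWeight z w (N + 1) k * (columnPoly z w N j).eval (k : ℝ) := fun j =>
    summable_particleWeight_poly hz hw hzw ((columnPoly_natDegree z w N j).trans (by omega))
  have hg := fun i j => hasSum_gapIndicator_mul la i (hf j)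
  have h := hasSum_det (fun (i j : Fin (N + 1)) (k : ℤ) => gapIndicator la i k *
    (particleWeight z w (N + 1) k * (columnPoly z w N j).eval (k : ℝ)))
    (fun i j => (hg i j).summable)
  simp only [(hg _ _).tsum_eq] at h
  rw [det_row_differences (fun i j : Fin (N + 1) => ∑' k : ℤ, halfLine la i k *
      (particleWeight z w (N + 1) k * (columnPoly z w N j).eval (k : ℝ))),
    det_partial_sums hz hw hzw] at h
  have hinj : Function.Injective
      (fun mu : {mu : Signature (N + 1) // Interlaces la mu} => posn mu.1) :=
    posn_injective.comp Subtype.val_injective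
  have hκ : (∏ d : Fin N, (2 * (z + w).re + 2 * N - (d : ℕ))) ≠ 0 :=
    (Finset.prod_pos fun d _ => coherence_pos hzw d).ne'
  rw [← hinj.hasSum_iff] at h
  · have h' := h.mul_left (((-1) ^ N * ∏ d : Fin N, (2 * (z + w).re + 2 * N - (d : ℕ)))⁻¹)
    have hsq : ((-1 : ℝ) ^ N) ≠ 0 := by simp
    rw [show (((-1 : ℝ) ^ N * ∏ d : Fin N, (2 * (z + w).re + 2 * N - (d : ℕ)))⁻¹) *
      ((-1) ^ N * (∑' k, particleWeight z w (N + 1) k) *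
      ((∏ i, particleWeight z w N (posn la i)) * vdm la)) =
      coherenceFactor z w N * ((∏ i, particleWeight z w N (posn la i)) * vdm la) by
        rw [coherenceFactor]; field_simp] at h'
    refine h'.congr_fun fun mu => ?_
    rw [← prod_columnPoly_coeff, eq_inv_mul_iff_mul_eq₀ (by
      rw [prod_columnPoly_coeff]; exact mul_ne_zero hsq hκ)]
    simp only [Function.comp_apply, gapIndicator_of_interlaces mu.2, one_mul]
    have hdet := Matrix.det_mul_column (fun i => particleWeight z w (N + 1) (posn mu.1 i))
      (Matrix.of fun i j : Fin (N + 1) => (columnPoly z w N j).eval (posn mu.1 i : ℝ))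
    rw [det_eval_polynomials _ _ (columnPoly_natDegree z w N), ← vdm] at hdet
    simp only [Matrix.of_apply] at hdet
    rw [hdet]
    ring
  · intro m hm
    by_cases hall : ∀ i : Fin N, m i.castSucc ≤ posn la i ∧ posn la i < m i.succ
    · have hmono : StrictMono m := Fin.strictMono_iff_lt_succ.mpr fun i =>
        (hall i).1.trans_lt (hall i).2
      refine absurd ⟨⟨ofPosn m hmono, ?_⟩, ?_⟩ hm
      · rw [interlaces_iff]; simpa using hall
      · simp
    · push Not at hall
      obtain ⟨i, hi⟩ := hall
      rcases lt_or_ge (posn la i) (m i.castSucc) with h1 | h1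
      · exact det_zero_of_row i.castSucc fun j => by
          rw [Matrix.of_apply, gapIndicator_castSucc_eq_zero h1, zero_mul]
      · exact det_zero_of_row i.succ fun j => by
          rw [Matrix.of_apply, gapIndicator_succ_eq_zero (hi h1), zero_mul]

/-! ### Normalization and coherence in `ℝ≥0∞` -/

/-- The weight of a single path ending at `s`. -/
noncomputable def pathWeight (z w : ℂ) {N : ℕ} (s : Signature N) : ℝ≥0∞ :=
  ENNReal.ofReal ((∏ i, particleWeight z w N (posn s i)) * dim s)

theorem particleWeight_nonneg (z w : ℂ) (N : ℕ) (n : ℤ) : 0 ≤ particleWeight z w N n := by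
  unfold particleWeight; positivity

theorem weight_eq_prod (z w : ℂ) {N : ℕ} (s : Signature N) :
    weight z w s =
      ENNReal.ofReal ((∏ i, particleWeight z w N (posn s i)) * (dim s : ℝ) ^ 2) := by
  rw [weight]
  congr 2
  refine Finset.prod_congr rfl fun i _ => ?_
  rw [particleWeight, posn]
  push_cast
  congr 5 <;> ring_nf

theorem weight_eq_pathWeight_mul (z w : ℂ) {N : ℕ} (s : Signature N) :
    weight z w s = pathWeight z w s * dim s := by
  rw [weight_eq_prod, pathWeight, ← ENNReal.ofReal_natCast (dim s), ← ENNReal.ofReal_mul]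
  · ring_nf
  · have := Finset.prod_nonneg fun i (_ : i ∈ Finset.univ) =>
      particleWeight_nonneg z w N (posn s i)
    positivity

section

variable {z w : ℂ}

theorem pathWeight_ne_zero (hz : ∀ n : ℤ, z ≠ n) (hw : ∀ n : ℤ, w ≠ n) {N : ℕ}
    (s : Signature N) : pathWeight z w s ≠ 0 := by
  have h1 := Finset.prod_pos fun i (_ : i ∈ Finset.univ) => particleWeight_pos hz hw N (posn s i)
  have h2 : (0 : ℝ) < dim s := by exact_mod_cast dim_pos s
  rw [pathWeight]
  exact (ENNReal.ofReal_pos.mpr (mul_pos h1 h2)).ne'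

theorem tsum_ofReal_of_hasSum {α : Type*} {f : α → ℝ} {a : ℝ} (hf : ∀ x, 0 ≤ f x)
    (h : HasSum f a) : ∑' x, ENNReal.ofReal (f x) = ENNReal.ofReal a := by
  rw [← ENNReal.ofReal_tsum_of_nonneg hf h.summable, h.tsum_eq]

theorem tsum_pathWeight (hz : ∀ n : ℤ, z ≠ n) (hw : ∀ n : ℤ, w ≠ n)
    (hzw : -(1 / 2 : ℝ) < (z + w).re) (N : ℕ) : ∃ c : ℝ≥0∞, c ≠ 0 ∧ c ≠ ⊤ ∧
      ∀ la : Signature N, ∑' mu : {mu : Signature (N + 1) // Interlaces la mu},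
        pathWeight z w mu.1 = c * pathWeight z w la := by
  refine ⟨ENNReal.ofReal (coherenceFactor z w N / N.factorial), ?_, ENNReal.ofReal_ne_top,
    fun la => ?_⟩
  · exact (ENNReal.ofReal_pos.mpr (div_pos (coherenceFactor_pos hz hw hzw N) (by positivity))).ne'
  · have hc := (coherenceFactor_pos hz hw hzw N).le
    have hnn : ∀ M, ∀ s : Signature M, 0 ≤ (∏ i, particleWeight z w M (posn s i)) * (dim s : ℝ) := by
      intro M s
      have := Finset.prod_nonneg fun i (_ : i ∈ Finset.univ) =>
        particleWeight_nonneg z w M (posn s i)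
      positivity
    have hs := hasSum_interlaces hz hw hzw la
    have hF : ((∏ k ∈ Finset.range (N + 1), k.factorial : ℕ) : ℝ) ≠ 0 := by
      exact_mod_cast (Finset.prod_pos fun k _ => Nat.factorial_pos k).ne'
    have hs' := hs.div_const ((∏ k ∈ Finset.range (N + 1), k.factorial : ℕ) : ℝ)
    have hterm : ∀ mu : {mu : Signature (N + 1) // Interlaces la mu},
        (∏ i, particleWeight z w (N + 1) (posn mu.1 i)) * vdm mu.1 /
          ((∏ k ∈ Finset.range (N + 1), k.factorial : ℕ) : ℝ) =
        (∏ i, particleWeight z w (N + 1) (posn mu.1 i)) * (dim mu.1 : ℝ) := by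
      intro mu
      rw [← dim_mul_factorials, ← mul_assoc, mul_div_cancel_right₀ _ hF]
    simp only [hterm] at hs'
    simp only [pathWeight]
    rw [tsum_ofReal_of_hasSum
      (fun mu : {mu : Signature (N + 1) // Interlaces la mu} => hnn (N + 1) mu.1) hs', ← ENNReal.ofReal_mul (by positivity)]
    congr 1
    have hF' : ((∏ k ∈ Finset.range N, k.factorial : ℕ) : ℝ) ≠ 0 := by
      exact_mod_cast (Finset.prod_pos fun k _ => Nat.factorial_pos k).ne'
    rw [← dim_mul_factorials, Finset.prod_range_succ]
    push_cast at hF' ⊢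
    field_simp

theorem tsum_interlaces_comm {N : ℕ} (f : Signature N → Signature (N + 1) → ℝ≥0∞) :
    ∑' mu : Signature (N + 1), ∑' la : {la : Signature N // Interlaces la mu}, f la.1 mu =
      ∑' la : Signature N, ∑' mu : {mu : Signature (N + 1) // Interlaces la mu}, f la mu.1 := by
  classical
  have h1 : ∀ mu : Signature (N + 1), ∑' la : {la : Signature N // Interlaces la mu}, f la.1 mu =
      ∑' la : Signature N, if Interlaces la mu then f la mu else 0 := fun mu => by
    refine (tsum_subtype {la : Signature N | Interlaces la mu} fun la => f la mu).trans ?_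
    simp [Set.indicator_apply]
  have h2 : ∀ la : Signature N, ∑' mu : {mu : Signature (N + 1) // Interlaces la mu}, f la mu.1 =
      ∑' mu : Signature (N + 1), if Interlaces la mu then f la mu else 0 := fun la => by
    refine (tsum_subtype {mu : Signature (N + 1) | Interlaces la mu} fun mu => f la mu).trans ?_
    simp [Set.indicator_apply]
  simp only [h1, h2]
  exact ENNReal.tsum_comm

theorem normalization_succ {N : ℕ} {c : ℝ≥0∞} (hc : ∀ la : Signature N,
      ∑' mu : {mu : Signature (N + 1) // Interlaces la mu}, pathWeight z w mu.1 =
        c * pathWeight z w la) :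
    normalization z w (N + 1) = c * normalization z w N := by
  have hd : ∀ mu : Signature (N + 1), ((dim mu : ℕ) : ℝ≥0∞) =
      ∑' la : {la : Signature N // Interlaces la mu}, (dim la.1 : ℝ≥0∞) := by
    intro mu
    have := Fintype.ofFinite {la : Signature N // Interlaces la mu}
    rw [dim_succ, tsum_fintype, tsum_fintype]
    push_cast
    rfl
  simp only [normalization, weight_eq_pathWeight_mul, hd, ← ENNReal.tsum_mul_left]
  rw [tsum_interlaces_comm (fun la mu => pathWeight z w mu * (dim la : ℝ≥0∞))]
  refine tsum_congr fun la => ?_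
  rw [ENNReal.tsum_mul_right, hc, mul_assoc]

theorem dim_zero (s : Signature 0) : dim s = 1 := by
  have h := dim_mul_factorials s
  simp [vdm] at h
  exact h

theorem pathWeight_zero (s : Signature 0) : pathWeight z w s = 1 := by
  simp [pathWeight, dim_zero]

theorem normalization_zero : normalization z w 0 = 1 := by
  rw [normalization, tsum_eq_single default (fun s hs => absurd (Subsingleton.elim s _) hs),
    weight_eq_pathWeight_mul, pathWeight_zero, dim_zero]
  simp

theorem normalization_ne (hz : ∀ n : ℤ, z ≠ n) (hw : ∀ n : ℤ, w ≠ n)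
    (hzw : -(1 / 2 : ℝ) < (z + w).re) (N : ℕ) :
    normalization z w N ≠ 0 ∧ normalization z w N ≠ ⊤ := by
  induction N with
  | zero => simp [normalization_zero]
  | succ N ih =>
    obtain ⟨c, h0, ht, hc⟩ := tsum_pathWeight hz hw hzw N
    rw [normalization_succ hc]
    exact ⟨mul_ne_zero h0 ih.1, ENNReal.mul_ne_top ht ih.2⟩

/-- The probability of a single path ending at `s`. -/
noncomputable def pathProb (z w : ℂ) {N : ℕ} (s : Signature N) : ℝ≥0∞ :=
  (normalization z w N)⁻¹ * pathWeight z w s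

theorem coherentSystem_div_dim {N : ℕ} (s : Signature N) :
    coherentSystem z w s / (dim s : ℝ≥0∞) = pathProb z w s := by
  have h : (dim s : ℝ≥0∞) ≠ 0 := by exact_mod_cast (dim_pos s).ne'
  rw [coherentSystem, weight_eq_pathWeight_mul, ← mul_assoc, pathProb,
    ENNReal.mul_div_cancel_right h (ENNReal.natCast_ne_top _)]

end

/-- A strictly positive normalized harmonic function on the graph. -/
structure IsHarmonic (q : (N : ℕ) → Signature N → ℝ≥0∞) : Prop where
  ne_zero : ∀ N s, q N s ≠ 0
  ne_top : ∀ N s, q N s ≠ ⊤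
  zero : ∀ s, q 0 s = 1
  tsum_eq : ∀ N (la : Signature N),
    ∑' mu : {mu : Signature (N + 1) // Interlaces la mu}, q (N + 1) mu.1 = q N la

theorem isHarmonic_pathProb {z w : ℂ} (hz : ∀ n : ℤ, z ≠ n) (hw : ∀ n : ℤ, w ≠ n)
    (hzw : -(1 / 2 : ℝ) < (z + w).re) : IsHarmonic fun _ s => pathProb z w s where
  ne_zero N s := mul_ne_zero (ENNReal.inv_ne_zero.mpr (normalization_ne hz hw hzw N).2)
    (pathWeight_ne_zero hz hw s)
  ne_top N s := ENNReal.mul_ne_top (ENNReal.inv_ne_top.mpr (normalization_ne hz hw hzw N).1)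
    ENNReal.ofReal_ne_top
  zero s := by simp [pathProb, normalization_zero, pathWeight_zero]
  tsum_eq N la := by
    obtain ⟨c, h0, ht, hc⟩ := tsum_pathWeight hz hw hzw N
    simp only [pathProb]
    rw [ENNReal.tsum_mul_left, hc, normalization_succ hc, ENNReal.mul_inv (Or.inl h0) (Or.inl ht),
      mul_mul_mul_comm, ENNReal.inv_mul_cancel h0 ht, one_mul]

/-! ### The measure on paths -/

instance signatureCountable (N : ℕ) : Countable (Signature N) :=
  inferInstanceAs (Countable {s : Fin N → ℤ // Antitone s})

instance finPathCountable (N : ℕ) : Countable (FinPath N) := by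
  refine Function.Injective.countable
    (f := fun (t : FinPath N) (k : Fin (N + 1)) => t.1 k (Nat.lt_succ_iff.mp k.2)) ?_
  intro t u h
  apply Subtype.ext
  funext k hk
  exact congrFun h ⟨k, Nat.lt_succ_iff.mpr hk⟩

theorem cylinders_countable : {C : Set GTPath | ∃ (N : ℕ) (τ : FinPath N), C = cylinder τ}.Countable := by
  have : {C : Set GTPath | ∃ (N : ℕ) (τ : FinPath N), C = cylinder τ} =
      Set.range fun x : Σ N, FinPath N => cylinder x.2 := by
    ext C
    constructor
    · rintro ⟨N, τ, rfl⟩; exact ⟨⟨N, τ⟩, rfl⟩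
    · rintro ⟨⟨N, τ⟩, rfl⟩; exact ⟨N, τ, rfl⟩
  rw [this]
  exact Set.countable_range _

instance pathsSecondCountable : SecondCountableTopology GTPath := ⟨⟨_, cylinders_countable, rfl⟩⟩

theorem borel_eq_generateFrom_cylinders : borel GTPath =
    MeasurableSpace.generateFrom {C | ∃ (N : ℕ) (τ : FinPath N), C = cylinder τ} :=
  borel_eq_generateFrom_of_subbasis rfl

theorem measurableSet_cylinder {N : ℕ} (τ : FinPath N) : MeasurableSet (cylinder τ) := by
  change MeasurableSet[borel GTPath] _
  rw [borel_eq_generateFrom_cylinders]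
  exact MeasurableSpace.measurableSet_generateFrom ⟨N, τ, rfl⟩

theorem isPiSystem_cylinders :
    IsPiSystem {C : Set GTPath | ∃ (N : ℕ) (τ : FinPath N), C = cylinder τ} := by
  rintro _ ⟨N, τ, rfl⟩ _ ⟨M, σ, rfl⟩ ⟨x, hx1, hx2⟩
  rcases le_total N M with h | h
  · refine ⟨M, σ, Set.inter_eq_right.mpr fun y hy k hk => ?_⟩
    rw [hy k (hk.trans h), ← hx2 k (hk.trans h), hx1 k hk]
  · refine ⟨N, τ, Set.inter_eq_left.mpr fun y hy k hk => ?_⟩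
    rw [hy k (hk.trans h), ← hx1 k (hk.trans h), hx2 k hk]

theorem measure_ext_of_cylinders {ρ ρ' : Measure GTPath} [IsProbabilityMeasure ρ]
    [IsProbabilityMeasure ρ']
    (h : ∀ (N : ℕ) (τ : FinPath N), ρ (cylinder τ) = ρ' (cylinder τ)) : ρ = ρ' := by
  refine ext_of_generate_finite _ borel_eq_generateFrom_cylinders isPiSystem_cylinders ?_ (by simp)
  rintro _ ⟨N, τ, rfl⟩
  exact h N τ

instance signatureMeasurableSpace (N : ℕ) : MeasurableSpace (Signature N) := ⊤

instance signatureDiscrete (N : ℕ) : DiscreteMeasurableSpace (Signature N) := ⟨fun _ => trivial⟩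

section

open ProbabilityTheory

variable {q : (N : ℕ) → Signature N → ℝ≥0∞}

open Classical in
/-- The distribution of the next level given the current one. -/
noncomputable def transition (hq : IsHarmonic q) {N : ℕ} (la : Signature N) :
    PMF (Signature (N + 1)) :=
  ⟨fun mu => if Interlaces la mu then q (N + 1) mu / q N la else 0, by
    have h := hq.tsum_eq N la
    have h' : ∑' mu, (if Interlaces la mu then q (N + 1) mu / q N la else 0) = 1 := by
      have e := tsum_subtype {mu | Interlaces la mu} fun mu => q (N + 1) mu / q N la
      simp only [Set.indicator_apply, Set.mem_ofPred_eq] at e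
      rw [← e]
      simp only [div_eq_mul_inv]
      rw [ENNReal.tsum_mul_right]
      exact (congrArg (· * (q N la)⁻¹) h).trans
        (ENNReal.mul_inv_cancel (hq.ne_zero N la) (hq.ne_top N la))
    rw [← h']
    exact ENNReal.summable.hasSum⟩

/-- The Markov kernel of the next level given the past. -/
noncomputable def transitionKernel (hq : IsHarmonic q) (N : ℕ) :
    Kernel ((i : Finset.Iic N) → Signature i) (Signature (N + 1)) :=
  Kernel.ofFunOfCountable fun y => (transition hq (y ⟨N, Finset.mem_Iic.mpr le_rfl⟩)).toMeasure

instance transitionKernel_isMarkov (hq : IsHarmonic q) (N : ℕ) :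
    IsMarkovKernel (transitionKernel hq N) :=
  ⟨fun y => PMF.toMeasure.isProbabilityMeasure
    (transition hq (y ⟨N, Finset.mem_Iic.mpr le_rfl⟩))⟩

/-- The law of the Markov chain. -/
noncomputable def chainMeasure (hq : IsHarmonic q) : Measure ((N : ℕ) → Signature N) :=
  Kernel.trajMeasure (X := fun N => Signature N) (Measure.dirac default) (transitionKernel hq)

instance chainMeasure_isProbability (hq : IsHarmonic q) :
    IsProbabilityMeasure (chainMeasure hq) := by
  unfold chainMeasure; infer_instance

theorem chainMeasure_map (hq : IsHarmonic q) (N : ℕ) :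
    (chainMeasure hq).map (Preorder.frestrictLe N) ⊗ₘ transitionKernel hq N =
      (chainMeasure hq).map (fun x => (Preorder.frestrictLe N x, x (N + 1))) :=
  Kernel.map_frestrictLe_trajMeasure_compProd_eq_map_trajMeasure

/-- The cylinder set of a finite path in the space of all sequences of signatures. -/
def seqCylinder {N : ℕ} (τ : FinPath N) : Set ((N : ℕ) → Signature N) :=
  {x | ∀ (k : ℕ) (h : k ≤ N), x k = τ.1 k h}

theorem seqCylinder_eq_preimage {N : ℕ} (τ : FinPath N) : seqCylinder τ =
    Preorder.frestrictLe N ⁻¹' {fun i : Finset.Iic N => τ.1 i (Finset.mem_Iic.mp i.2)} := by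
  ext x
  simp only [seqCylinder, Set.mem_ofPred_eq, Set.mem_preimage, Set.mem_singleton_iff]
  constructor
  · intro h; funext i; exact h i (Finset.mem_Iic.mp i.2)
  · intro h k hk; exact congrFun h (⟨k, Finset.mem_Iic.mpr hk⟩ : Finset.Iic N)

theorem measurableSet_seqCylinder {N : ℕ} (τ : FinPath N) : MeasurableSet (seqCylinder τ) := by
  rw [seqCylinder_eq_preimage]
  exact (Preorder.measurable_frestrictLe N) (MeasurableSet.singleton _)

theorem chainMeasure_seqCylinder (hq : IsHarmonic q) {N : ℕ} (τ : FinPath N) :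
    chainMeasure hq (seqCylinder τ) = q N τ.endpoint := by
  induction N with
  | zero =>
    rw [hq.zero]
    convert! measure_univ (μ := chainMeasure hq)
    rw [Set.eq_univ_iff_forall]
    intro x k hk
    obtain rfl := Nat.le_zero.mp hk
    exact Subsingleton.elim _ _
  | succ N ih =>
    have hpre : seqCylinder τ = (fun x => (Preorder.frestrictLe N x, x (N + 1))) ⁻¹'
        ({fun i : Finset.Iic N => τ.init.1 i (Finset.mem_Iic.mp i.2)} ×ˢ {τ.endpoint}) := by
      ext x
      have h1 : x ∈ seqCylinder τ ↔ x ∈ seqCylinder τ.init ∧ x (N + 1) = τ.endpoint := by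
        constructor
        · intro h
          exact ⟨fun k hk => h k (hk.trans N.le_succ), h _ le_rfl⟩
        · rintro ⟨h1, h2⟩ k hk
          rcases Nat.lt_or_ge N k with h | h
          · obtain rfl : k = N + 1 := by omega
            exact h2
          · exact h1 k h
      rw [h1, seqCylinder_eq_preimage]
      rfl
    have hms : MeasurableSet ({fun i : Finset.Iic N => τ.init.1 i (Finset.mem_Iic.mp i.2)} :
      Set ((i : Finset.Iic N) → Signature i)) := MeasurableSet.singleton _
    rw [hpre, ← Measure.map_apply (by fun_prop) (hms.prod (MeasurableSet.singleton _)),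
      ← chainMeasure_map, Measure.compProd_apply_prod hms (MeasurableSet.singleton _),
      lintegral_singleton, Measure.map_apply (by fun_prop) hms, ← seqCylinder_eq_preimage,
      ih τ.init]
    have hk : transitionKernel hq N (fun i : Finset.Iic N => τ.init.1 i (Finset.mem_Iic.mp i.2)) {τ.endpoint} =
        q (N + 1) τ.endpoint / q N τ.init.endpoint := by
      change (transition hq τ.init.endpoint).toMeasure {τ.endpoint} = _
      rw [PMF.toMeasure_apply_singleton _ _ (MeasurableSet.singleton _)]
      exact if_pos τ.interlaces_init
    rw [hk, ENNReal.div_mul_cancel (hq.ne_zero _ _) (hq.ne_top _ _)]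

theorem measurableSet_interlaces (N : ℕ) :
    MeasurableSet {x : (N : ℕ) → Signature N | Interlaces (x N) (x (N + 1))} := by
  have h : Measurable fun x : (N : ℕ) → Signature N => (x N, x (N + 1)) := by fun_prop
  exact h (MeasurableSet.of_discrete (s := {p : Signature N × Signature (N + 1) |
    Interlaces p.1 p.2}))

theorem chainMeasure_ae_interlaces (hq : IsHarmonic q) :
    ∀ᵐ x ∂chainMeasure hq, ∀ N, Interlaces (x N) (x (N + 1)) := by
  rw [ae_all_iff]
  intro N
  let S : Set (((i : Finset.Iic N) → Signature i) × Signature (N + 1)) :=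
    {p | ¬ Interlaces (p.1 ⟨N, Finset.mem_Iic.mpr le_rfl⟩) p.2}
  have hS : MeasurableSet S := MeasurableSet.of_discrete
  have h0 : (chainMeasure hq).map (fun x => (Preorder.frestrictLe N x, x (N + 1))) S = 0 := by
    rw [← chainMeasure_map, Measure.compProd_apply hS, ← lintegral_zero]
    refine lintegral_congr fun y => ?_
    change (transition hq (y ⟨N, Finset.mem_Iic.mpr le_rfl⟩)).toMeasure (Prod.mk y ⁻¹' S) = 0
    rw [PMF.toMeasure_apply_eq_zero_iff _ MeasurableSet.of_discrete, Set.disjoint_left]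
    intro mu hmu hmem
    rw [PMF.mem_support_iff] at hmu
    exact hmu (if_neg hmem)
  rw [Measure.map_apply (by fun_prop) hS] at h0
  exact h0

instance pathsNonempty : Nonempty GTPath :=
  ⟨⟨fun _ => ⟨fun _ => 0, fun _ _ _ => le_rfl⟩, fun _ _ => ⟨le_rfl, le_rfl⟩⟩⟩

open Classical in
/-- Retraction of the sequences of signatures onto the paths. -/
noncomputable def toPath (x : (N : ℕ) → Signature N) : GTPath :=
  if h : ∀ N, Interlaces (x N) (x (N + 1)) then ⟨x, h⟩ else Classical.arbitrary _

theorem measurable_toPath : Measurable toPath := by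
  change Measurable[_, borel GTPath] toPath
  rw [borel_eq_generateFrom_cylinders]
  refine measurable_generateFrom ?_
  rintro _ ⟨N, τ, rfl⟩
  have hV : MeasurableSet {x : (N : ℕ) → Signature N | ∀ N, Interlaces (x N) (x (N + 1))} := by
    have : {x : (N : ℕ) → Signature N | ∀ N, Interlaces (x N) (x (N + 1))} =
        ⋂ N, {x : (N : ℕ) → Signature N | Interlaces (x N) (x (N + 1))} := by ext x; simp
    rw [this]
    exact MeasurableSet.iInter measurableSet_interlaces
  have h : toPath ⁻¹' cylinder τ =
      ({x : (N : ℕ) → Signature N | ∀ N, Interlaces (x N) (x (N + 1))} ∩ seqCylinder τ) ∪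
      ({x : (N : ℕ) → Signature N | ∀ N, Interlaces (x N) (x (N + 1))}ᶜ ∩
        {_x | Classical.arbitrary GTPath ∈ cylinder τ}) := by
    ext x
    by_cases hx : ∀ N, Interlaces (x N) (x (N + 1))
    · have e : toPath x = ⟨x, hx⟩ := dif_pos hx
      simp only [Set.mem_preimage, e, Set.mem_union, Set.mem_inter_iff, Set.mem_compl_iff,
        Set.mem_ofPred_eq]
      exact ⟨fun h => Or.inl ⟨hx, h⟩, fun h => h.elim (fun h => h.2) (fun h => absurd hx h.1)⟩
    · have e : toPath x = Classical.arbitrary _ := dif_neg hx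
      simp only [Set.mem_preimage, e, Set.mem_union, Set.mem_inter_iff, Set.mem_compl_iff,
        Set.mem_ofPred_eq]
      exact ⟨fun h => Or.inr ⟨hx, h⟩, fun h => h.elim (fun h => absurd h.1 hx) (fun h => h.2)⟩
  rw [h]
  exact (hV.inter (measurableSet_seqCylinder τ)).union (hV.compl.inter (MeasurableSet.const _))

theorem exists_measure_of_isHarmonic (hq : IsHarmonic q) : ∃ ρ : Measure GTPath,
    IsProbabilityMeasure ρ ∧ ∀ (N : ℕ) (τ : FinPath N), ρ (cylinder τ) = q N τ.endpoint := by
  refine ⟨(chainMeasure hq).map toPath,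
    Measure.isProbabilityMeasure_map measurable_toPath.aemeasurable, fun N τ => ?_⟩
  rw [Measure.map_apply measurable_toPath (measurableSet_cylinder τ),
    ← chainMeasure_seqCylinder hq τ]
  refine measure_congr ?_
  filter_upwards [chainMeasure_ae_interlaces hq] with x hx
  have e : toPath x = ⟨x, hx⟩ := dif_pos hx
  refine propext ?_
  change toPath x ∈ cylinder τ ↔ x ∈ seqCylinder τ
  rw [e]
  rfl

end

theorem existsUnique_zwMeasure {z w : ℂ} (hz : ∀ n : ℤ, z ≠ n) (hw : ∀ n : ℤ, w ≠ n)
    (hzw : -(1 / 2 : ℝ) < (z + w).re) : ∃! ρ : Measure GTPath, IsZWMeasure z w ρ := by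
  obtain ⟨ρ, hρ, h⟩ := exists_measure_of_isHarmonic (isHarmonic_pathProb hz hw hzw)
  refine ⟨ρ, ⟨hρ, fun N τ => by rw [h, coherentSystem_div_dim]⟩, fun ρ' h' => ?_⟩
  have := h'.isProbabilityMeasure
  exact measure_ext_of_cylinders fun N τ => by rw [h'.apply_cylinder, h, coherentSystem_div_dim]

/-! ### Particle configurations -/

/-- The particle configuration of a signature. -/
def config {N : ℕ} (s : Signature N) : Finset ℤ := Finset.univ.image (posn s)

theorem card_config {N : ℕ} (s : Signature N) : (config s).card = N := by
  rw [config, Finset.card_image_of_injective _ (posn_strictMono s).injective]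
  simp

theorem config_injective {N : ℕ} : Function.Injective (config (N := N)) := by
  intro s t h
  apply posn_injective
  have hs := Finset.orderEmbOfFin_unique (card_config s) (f := posn s)
    (fun i => Finset.mem_image_of_mem _ (Finset.mem_univ i)) (posn_strictMono s)
  have ht := Finset.orderEmbOfFin_unique (card_config s) (f := posn t)
    (fun i => by rw [h]; exact Finset.mem_image_of_mem _ (Finset.mem_univ i)) (posn_strictMono t)
  rw [hs, ht]

theorem exists_config {N : ℕ} {L : Finset ℤ} (hL : L.card = N) :
    ∃ s : Signature N, config s = L := by
  refine ⟨ofPosn (L.orderEmbOfFin hL) (L.orderEmbOfFin hL).strictMono, ?_⟩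
  rw [config, posn_ofPosn]
  apply Finset.coe_injective
  simp

/-- The unnormalized weight of a configuration. -/
noncomputable def configWeight (U : ℤ → ℝ) (L : Finset ℤ) : ℝ :=
  (∏ x ∈ L, U x) * ∏ x ∈ L, ∏ y ∈ L.erase x, |(x : ℝ) - y|

theorem vdm_sq {N : ℕ} (s : Signature N) :
    vdm s ^ 2 = ∏ x ∈ config s, ∏ y ∈ (config s).erase x, |(x : ℝ) - y| := by
  have hinj := (posn_strictMono s).injective
  have hI : ∏ x ∈ config s, ∏ y ∈ (config s).erase x, |(x : ℝ) - y| =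
      ∏ i, ∏ j ∈ Finset.univ.erase i, |(posn s i : ℝ) - posn s j| := by
    rw [config, Finset.prod_image hinj.injOn]
    refine Finset.prod_congr rfl fun i _ => ?_
    rw [← Finset.image_erase hinj, Finset.prod_image hinj.injOn]
  have hsplit : ∀ i : Fin N, ∏ j ∈ Finset.univ.erase i, |(posn s i : ℝ) - posn s j| =
      (∏ j ∈ Finset.Ioi i, |(posn s i : ℝ) - posn s j|) *
        ∏ j ∈ Finset.Iio i, |(posn s i : ℝ) - posn s j| := by
    intro i
    rw [← Finset.prod_union]
    · congr 1
      ext j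
      simp only [Finset.mem_erase, Finset.mem_univ, and_true, Finset.mem_union, Finset.mem_Ioi,
        Finset.mem_Iio]
      exact ne_iff_lt_or_gt.trans or_comm
    · rw [Finset.disjoint_left]
      intro j h1 h2
      exact lt_asymm (Finset.mem_Ioi.mp h1) (Finset.mem_Iio.mp h2)
  have hswap : ∏ i, ∏ j ∈ Finset.Iio i, |(posn s i : ℝ) - posn s j| =
      ∏ i, ∏ j ∈ Finset.Ioi i, |(posn s i : ℝ) - posn s j| := by
    rw [Finset.prod_comm' (t' := Finset.univ) (s' := fun j => Finset.Ioi j) (by simp)]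
    exact Finset.prod_congr rfl fun i _ => Finset.prod_congr rfl fun j _ => abs_sub_comm _ _
  have hv : vdm s = ∏ i, ∏ j ∈ Finset.Ioi i, |(posn s i : ℝ) - posn s j| := by
    rw [vdm, Matrix.det_vandermonde]
    refine Finset.prod_congr rfl fun i _ => Finset.prod_congr rfl fun j hj => ?_
    rw [abs_sub_comm, abs_of_pos]
    rw [sub_pos]
    exact_mod_cast posn_strictMono s (Finset.mem_Ioi.mp hj)
  rw [hI]
  simp only [hsplit]
  rw [Finset.prod_mul_distrib, hswap, ← hv, sq]

theorem weight_eq_configWeight (z w : ℂ) {N : ℕ} (s : Signature N) :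
    weight z w s = ENNReal.ofReal (((∏ k ∈ Finset.range N, k.factorial : ℕ) : ℝ) ^ 2)⁻¹ *
      ENNReal.ofReal (configWeight (particleWeight z w N) (config s)) := by
  have hF : ((∏ k ∈ Finset.range N, k.factorial : ℕ) : ℝ) ≠ 0 := by
    exact_mod_cast (Finset.prod_pos fun k _ => Nat.factorial_pos k).ne'
  rw [weight_eq_prod, ← ENNReal.ofReal_mul (by positivity), configWeight, ← vdm_sq,
    ← dim_mul_factorials, config, Finset.prod_image (posn_strictMono s).injective.injOn]
  congr 1
  field_simp

theorem configWeight_insert (U : ℤ → ℝ) {K : Finset ℤ} {c : ℤ} (hc : c ∉ K) :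
    configWeight U (insert c K) = U c * (∏ x ∈ K, |(c : ℝ) - x|) ^ 2 * configWeight U K := by
  have h1 : ∏ x ∈ K, ∏ y ∈ (insert c K).erase x, |(x : ℝ) - y| =
      (∏ x ∈ K, |(c : ℝ) - x|) * ∏ x ∈ K, ∏ y ∈ K.erase x, |(x : ℝ) - y| := by
    rw [← Finset.prod_mul_distrib]
    refine Finset.prod_congr rfl fun x hx => ?_
    have hne : c ≠ x := fun h => hc (h ▸ hx)
    rw [Finset.erase_insert_of_ne hne, Finset.prod_insert (fun h => hc (Finset.mem_of_mem_erase h)),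
      abs_sub_comm]
  rw [configWeight, configWeight, Finset.prod_insert hc, Finset.prod_insert hc,
    Finset.erase_insert hc, h1]
  ring

theorem configWeight_nonneg {U : ℤ → ℝ} (hU : ∀ x, 0 ≤ U x) (L : Finset ℤ) :
    0 ≤ configWeight U L :=
  mul_nonneg (Finset.prod_nonneg fun x _ => hU x)
    (Finset.prod_nonneg fun _ _ => Finset.prod_nonneg fun _ _ => abs_nonneg _)

/-- The configuration in which a particle has been moved from `a` to `b`. -/
def move (L : Finset ℤ) (a b : ℤ) : Finset ℤ := insert b (L.erase a)

theorem card_move {L : Finset ℤ} {a b : ℤ} (ha : a ∈ L) (hb : b ∉ L) :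
    (move L a b).card = L.card := by
  rw [move, Finset.card_insert_of_notMem (fun h => hb (Finset.mem_of_mem_erase h)),
    Finset.card_erase_add_one ha]

theorem erase_insert_move {L : Finset ℤ} {a b : ℤ} (ha : a ∈ L) (hb : b ∉ L) :
    insert a ((move L a b).erase b) = L := by
  rw [move, Finset.erase_insert (fun h => hb (Finset.mem_of_mem_erase h)), Finset.insert_erase ha]

theorem configWeight_move {U : ℤ → ℝ} (hU : ∀ x, 0 ≤ U x) {L : Finset ℤ} {a b : ℤ} (ha : a ∈ L)
    (hb : b ∉ L) {ε : ℝ}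
    (h : ε * (U a * (∏ x ∈ L.erase a, |(a : ℝ) - x|) ^ 2) ≤
      U b * (∏ x ∈ L.erase a, |(b : ℝ) - x|) ^ 2) :
    ε * configWeight U L ≤ configWeight U (move L a b) := by
  have h1 := configWeight_insert U (Finset.notMem_erase a L)
  rw [Finset.insert_erase ha] at h1
  rw [h1, move, configWeight_insert U (fun h => hb (Finset.mem_of_mem_erase h)), ← mul_assoc]
  exact mul_le_mul_of_nonneg_right h (configWeight_nonneg hU _)

/-! ### The counting argument -/

theorem tsum_move_le (G : Finset ℤ → ℝ≥0∞) (D : Set (Finset ℤ)) {a b : ℤ}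
    (hD : ∀ L ∈ D, a ∈ L ∧ b ∉ L) :
    ∑' L : D, G (move L a b) ≤ ∑' L, G L := by
  have hinj : Function.Injective fun L : D => move L.1 a b := by
    intro L M h
    apply Subtype.ext
    rw [← erase_insert_move (hD L.1 L.2).1 (hD L.1 L.2).2,
      ← erase_insert_move (hD M.1 M.2).1 (hD M.1 M.2).2]
    exact congrArg (fun x => insert a (x.erase b)) h
  exact ENNReal.tsum_comp_le_tsum_of_injective hinj G

open Classical in
theorem counting_moves (G : Finset ℤ → ℝ≥0∞) (S : Finset ℤ) (P : Finset (ℤ × ℤ))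
    (hP : ∀ p ∈ P, p.1 ∈ S ∧ p.2 ∉ S) (K : ℕ) (A : Set (Finset ℤ))
    (hA : ∀ L ∈ A, (L \ S).card ≤ K ∧ (S \ L).card ≤ K) (δ : ℝ≥0∞)
    (h : ∀ L ∈ A, δ * G L ≤ ∑ p ∈ P with p.1 ∈ L ∧ p.2 ∉ L, G (move L p.1 p.2)) :
    δ * ∑' L : A, G L ≤ (K + 1) ^ 2 * ∑' L, G L := by
  let C : ℤ × ℤ → Set (Finset ℤ) := fun p =>
    {L | (L \ S).card ≤ K + 1 ∧ (S \ L).card ≤ K + 1 ∧ p.1 ∈ S \ L ∧ p.2 ∈ L \ S}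
  have hmem : ∀ p ∈ P, ∀ L ∈ A, p.1 ∈ L → p.2 ∉ L → move L p.1 p.2 ∈ C p := by
    intro p hp L hL h1 h2
    obtain ⟨hp1, hp2⟩ := hP p hp
    have hne : p.1 ≠ p.2 := fun e => h2 (e ▸ h1)
    refine ⟨?_, ?_, ?_, ?_⟩
    · refine (Finset.card_le_card (t := insert p.2 (L \ S)) ?_).trans
        ((Finset.card_insert_le _ _).trans (Nat.succ_le_succ (hA L hL).1))
      intro x
      simp only [move, Finset.mem_sdiff, Finset.mem_insert, Finset.mem_erase]
      tauto
    · refine (Finset.card_le_card (t := insert p.1 (S \ L)) ?_).trans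
        ((Finset.card_insert_le _ _).trans (Nat.succ_le_succ (hA L hL).2))
      intro x
      simp only [move, Finset.mem_sdiff, Finset.mem_insert, Finset.mem_erase]
      tauto
    · simp [move, hp1, hne]
    · simp [move, hp2]
  calc δ * ∑' L : A, G L = ∑' L : A, δ * G L := ENNReal.tsum_mul_left.symm
    _ ≤ ∑' L : A, ∑ p ∈ P, if p.1 ∈ L.1 ∧ p.2 ∉ L.1 then G (move L p.1 p.2) else 0 := by
        refine ENNReal.tsum_le_tsum fun L => ?_
        rw [← Finset.sum_filter]
        exact h L.1 L.2
    _ = ∑ p ∈ P, ∑' L : A, if p.1 ∈ L.1 ∧ p.2 ∉ L.1 then G (move L p.1 p.2) else 0 :=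
        Summable.tsum_finsetSum fun _ _ => ENNReal.summable
    _ ≤ ∑ p ∈ P, ∑' L, (C p).indicator G L := by
        refine Finset.sum_le_sum fun p hp => ?_
        refine le_trans ?_ (tsum_move_le ((C p).indicator G) {L | L ∈ A ∧ p.1 ∈ L ∧ p.2 ∉ L}
          (a := p.1) (b := p.2) fun L hL => hL.2)
        refine le_of_eq ?_
        rw [tsum_subtype A (fun L => if p.1 ∈ L ∧ p.2 ∉ L then G (move L p.1 p.2) else 0),
          tsum_subtype {L | L ∈ A ∧ p.1 ∈ L ∧ p.2 ∉ L}
            (fun L => (C p).indicator G (move L p.1 p.2))]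
        refine tsum_congr fun L => ?_
        by_cases h1 : L ∈ A
        · by_cases h2 : p.1 ∈ L ∧ p.2 ∉ L
          · have h3 : L ∈ {L | L ∈ A ∧ p.1 ∈ L ∧ p.2 ∉ L} := ⟨h1, h2⟩
            rw [Set.indicator_of_mem h1, Set.indicator_of_mem h3, if_pos h2,
              Set.indicator_of_mem (hmem p hp L h1 h2.1 h2.2)]
          · have h3 : L ∉ {L | L ∈ A ∧ p.1 ∈ L ∧ p.2 ∉ L} := fun h => h2 h.2
            rw [Set.indicator_of_mem h1, Set.indicator_of_notMem h3, if_neg h2]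
        · have h3 : L ∉ {L | L ∈ A ∧ p.1 ∈ L ∧ p.2 ∉ L} := fun h => h1 h.1
          rw [Set.indicator_of_notMem h1, Set.indicator_of_notMem h3]
    _ = ∑' L, ∑ p ∈ P, (C p).indicator G L :=
        (Summable.tsum_finsetSum fun _ _ => ENNReal.summable).symm
    _ ≤ ∑' L, ((K : ℝ≥0∞) + 1) ^ 2 * G L := by
        refine ENNReal.tsum_le_tsum fun L => ?_
        simp only [Set.indicator_apply]
        rw [← Finset.sum_filter, Finset.sum_const, nsmul_eq_mul]
        refine mul_le_mul_left ?_ _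
        by_cases hL : (L \ S).card ≤ K + 1 ∧ (S \ L).card ≤ K + 1
        · have hsub : {p ∈ P | L ∈ C p} ⊆ (S \ L) ×ˢ (L \ S) := by
            intro p hp
            exact Finset.mem_product.mpr (Finset.mem_filter.mp hp).2.2.2
          have := (Finset.card_le_card hsub).trans_eq (Finset.card_product _ _)
          have h2 := this.trans (Nat.mul_le_mul hL.2 hL.1)
          rw [sq]
          exact_mod_cast h2
        · rw [Finset.filter_false_of_mem fun p _ h => hL ⟨h.1, h.2.1⟩]
          simp
    _ = (K + 1) ^ 2 * ∑' L, G L := ENNReal.tsum_mul_left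

/-! ### Comparison of weights after a move -/

theorem rpow_comparison {u v : ℝ} (hu : 0 < u) (hv : 0 < v) (h1 : v ≤ 8 * u) (h2 : u ≤ 8 * v)
    (x : ℝ) : (8 : ℝ) ^ (-|x|) * v ^ x ≤ u ^ x := by
  have e : u ^ x = (u / v) ^ x * v ^ x := by
    rw [← Real.mul_rpow (by positivity) hv.le, div_mul_cancel₀ _ hv.ne']
  rw [e]
  refine mul_le_mul_of_nonneg_right ?_ (by positivity)
  rcases le_total 0 x with hx | hx
  · rw [abs_of_nonneg hx, Real.rpow_neg (by norm_num), ← Real.inv_rpow (by norm_num)]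
    refine Real.rpow_le_rpow (by norm_num) ?_ hx
    rw [le_div_iff₀ hv]; linarith
  · rw [abs_of_nonpos hx, neg_neg]
    refine Real.rpow_le_rpow_of_nonpos (by positivity) ?_ hx
    rw [div_le_iff₀ hv]; linarith

theorem particleWeight_ratio {z w : ℂ} (hz : ∀ n : ℤ, z ≠ n) (hw : ∀ n : ℤ, w ≠ n) :
    ∃ c : ℝ, 0 < c ∧ ∀ N R p q : ℕ, 1 ≤ R → 8 * R ≤ N → R ≤ p → p < 2 * R → R ≤ q → q < 2 * R →
      c / R * ‖1 / (Complex.Gamma (z + 1 + (q : ℤ)) * Complex.Gamma (w + N - (q : ℤ)))‖ *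
          (q.factorial * (N - 1 - q).factorial) ≤
        ‖1 / (Complex.Gamma (z + 1 + (-1 - p : ℤ)) * Complex.Gamma (w + N - (-1 - p : ℤ)))‖ *
          ((p + N).factorial / (p.factorial * (p + q + 1))) := by
  obtain ⟨c1, _, hc1, _, h1⟩ := gamma_bounds (neg_not_int hz)
  obtain ⟨c2, _, hc2, _, h2⟩ := gamma_bounds hz
  obtain ⟨c3, C3, hc3, hC3, h3⟩ := gamma_bounds hw
  set A := ‖Complex.sin (Real.pi * z)‖ / Real.pi with hA
  have hA0 : 0 < A := div_pos (norm_sin_pi_pos hz) Real.pi_pos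
  set x := z.re
  set y := w.re
  set κ := (8 : ℝ) ^ (-|x|) * (8 : ℝ) ^ (-|y|) with hκ
  have hκ0 : 0 < κ := by positivity
  refine ⟨A * c1 * c2 * c3 * κ / (5 * C3), by positivity, ?_⟩
  intro N R p q hR hN hp1 hp2 hq1 hq2
  obtain ⟨n, hn⟩ : ∃ n, N = n + q + 1 := ⟨N - q - 1, by omega⟩
  have hp0 : 1 ≤ p := hR.trans hp1
  have hq0 : 1 ≤ q := hR.trans hq1
  have hn0 : 1 ≤ n := by omega
  have e1 : z + 1 + ((q : ℤ) : ℂ) = z + q + 1 := by push_cast; ring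
  have e2 : w + N - ((q : ℤ) : ℂ) = w + n + 1 := by rw [hn]; push_cast; ring
  have e3 : z + 1 + ((-1 - p : ℤ) : ℂ) = z - p := by push_cast; ring
  have e4 : w + N - ((-1 - p : ℤ) : ℂ) = w + (p + N : ℕ) + 1 := by push_cast; ring
  have e5 : N - 1 - q = n := by omega
  rw [e1, e2, e3, e4, e5, norm_div, norm_div, norm_one, norm_mul, norm_mul, one_div, one_div,
    mul_inv ‖Complex.Gamma (z - p)‖, norm_inv_gamma_sub_nat hz p, ← hA]
  have b1 := (h1 p hp0).1
  have b2 := (h2 q hq0).1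
  have b3 := (h3 n hn0).1
  have b4 := (h3 (p + N) (by omega)).2
  have hp' : (0 : ℝ) < p := by exact_mod_cast hp0
  have hq' : (0 : ℝ) < q := by exact_mod_cast hq0
  have hn' : (0 : ℝ) < n := by exact_mod_cast hn0
  have hN' : (0 : ℝ) < (p + N : ℕ) := by exact_mod_cast (show 0 < p + N by omega)
  have hR' : (0 : ℝ) < R := by exact_mod_cast hR
  have hG4 : 0 < ‖Complex.Gamma (w + (p + N : ℕ) + 1)‖ :=
    lt_of_lt_of_le (by positivity) (h3 (p + N) (by omega)).1
  have k1 : (8 : ℝ) ^ (-|x|) * (p : ℝ) ^ x ≤ (q : ℝ) ^ x := by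
    refine rpow_comparison hq' hp' ?_ ?_ x
    · exact_mod_cast (show p ≤ 8 * q by omega)
    · exact_mod_cast (show q ≤ 8 * p by omega)
  have k2 : (8 : ℝ) ^ (-|y|) * ((p + N : ℕ) : ℝ) ^ y ≤ (n : ℝ) ^ y := by
    refine rpow_comparison hn' hN' ?_ ?_ y
    · exact_mod_cast (show p + N ≤ 8 * n by omega)
    · exact_mod_cast (show n ≤ 8 * (p + N) by omega)
  have k3 : (p : ℝ) + q + 1 ≤ 5 * R := by exact_mod_cast (show p + q + 1 ≤ 5 * R by omega)
  have k : κ * ((p : ℝ) ^ x * ((p + N : ℕ) : ℝ) ^ y) ≤ (q : ℝ) ^ x * (n : ℝ) ^ y := by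
    calc κ * ((p : ℝ) ^ x * ((p + N : ℕ) : ℝ) ^ y)
        = ((8 : ℝ) ^ (-|x|) * (p : ℝ) ^ x) * ((8 : ℝ) ^ (-|y|) * ((p + N : ℕ) : ℝ) ^ y) := by
          rw [hκ]; ring
      _ ≤ _ := mul_le_mul k1 k2 (by positivity) (by positivity)
  rw [Complex.neg_re] at b1
  rw [Real.rpow_neg hp'.le] at b1
  have hqf : (0 : ℝ) < q.factorial := by positivity
  have hnf : (0 : ℝ) < n.factorial := by positivity
  have hpf : (0 : ℝ) < p.factorial := by positivity
  have hNf : (0 : ℝ) < (p + N).factorial := by positivity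
  calc A * c1 * c2 * c3 * κ / (5 * C3) / R *
        (‖Complex.Gamma (z + q + 1)‖ * ‖Complex.Gamma (w + n + 1)‖)⁻¹ *
        (q.factorial * n.factorial)
      ≤ A * c1 * c2 * c3 * κ / (5 * C3) / R *
        ((c2 * ((q : ℝ) ^ x * q.factorial)) * (c3 * ((n : ℝ) ^ y * n.factorial)))⁻¹ *
        (q.factorial * n.factorial) := by gcongr
    _ = A * c1 / (C3 * (5 * R)) * (κ / ((q : ℝ) ^ x * (n : ℝ) ^ y)) := by field_simp
    _ ≤ A * c1 / (C3 * (p + q + 1)) * (1 / ((p : ℝ) ^ x * ((p + N : ℕ) : ℝ) ^ y)) := by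
        have : κ / ((q : ℝ) ^ x * (n : ℝ) ^ y) ≤ 1 / ((p : ℝ) ^ x * ((p + N : ℕ) : ℝ) ^ y) := by
          rw [div_le_div_iff₀ (by positivity) (by positivity), one_mul]
          exact k
        gcongr
    _ = A * (c1 * (((p : ℝ) ^ x)⁻¹ * p.factorial)) *
          (C3 * (((p + N : ℕ) : ℝ) ^ y * (p + N).factorial))⁻¹ *
          ((p + N).factorial / (p.factorial * (p + q + 1))) := by field_simp
    _ ≤ A * ‖Complex.Gamma (-z + p + 1)‖ * ‖Complex.Gamma (w + (p + N : ℕ) + 1)‖⁻¹ *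
          ((p + N).factorial / (p.factorial * (p + q + 1))) := by gcongr

/-! ### Moves out of the sea `{0, …, N - 1}` -/

theorem prod_range_ite_ne {M : Type*} [CommMonoid M] (f : ℕ → M) {N q : ℕ} (hq : q < N) :
    ∏ x ∈ (Finset.range N).erase q, f x =
      (∏ x ∈ Finset.range q, f x) * ∏ x ∈ Finset.range (N - 1 - q), f (q + 1 + x) := by
  classical
  obtain ⟨r, rfl⟩ : ∃ r, N = q + 1 + r := ⟨N - 1 - q, by omega⟩
  rw [show q + 1 + r - 1 - q = r by omega]
  have h1 : (Finset.range (q + 1 + r)).erase q =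
      Finset.range q ∪ Finset.Ico (q + 1) (q + 1 + r) := by
    ext x
    simp only [Finset.mem_erase, Finset.mem_range, Finset.mem_union, Finset.mem_Ico]
    omega
  rw [h1, Finset.prod_union, Finset.prod_Ico_eq_prod_range]
  · congr 3
    omega
  · rw [Finset.disjoint_left]
    intro x hx hx'
    rw [Finset.mem_range] at hx
    rw [Finset.mem_Ico] at hx'
    omega

/-- The configuration of the zero signature. -/
noncomputable def sea (N : ℕ) : Finset ℤ := Finset.Ico 0 N

theorem prod_sea_erase (N : ℕ) (q : ℕ) (f : ℤ → ℝ) :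
    ∏ x ∈ (sea N).erase q, f x = ∏ x ∈ (Finset.range N).erase q, f x := by
  have h : (sea N).erase q = ((Finset.range N).erase q).image (fun n : ℕ => (n : ℤ)) := by
    ext x
    simp only [sea, Finset.mem_erase, Finset.mem_Ico, Finset.mem_image, Finset.mem_range]
    constructor
    · rintro ⟨h1, h2, h3⟩
      exact ⟨x.toNat, by omega, by omega⟩
    · rintro ⟨n, h1, rfl⟩
      omega
  rw [h, Finset.prod_image (fun _ _ _ _ h => by exact_mod_cast h)]

theorem prod_sea_inside {N q : ℕ} (hq : q < N) :
    ∏ x ∈ (sea N).erase q, |((q : ℤ) : ℝ) - x| = q.factorial * (N - 1 - q).factorial := by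
  rw [prod_sea_erase N q (fun x => |((q : ℤ) : ℝ) - x|),
    prod_range_ite_ne (fun x : ℕ => |((q : ℤ) : ℝ) - ((x : ℤ) : ℝ)|) hq]
  congr 1
  · rw [← Finset.prod_range_reflect, ← Finset.prod_range_add_one_eq_factorial]
    push_cast
    refine Finset.prod_congr rfl fun x hx => ?_
    rw [Finset.mem_range] at hx
    rw [show q - 1 - x = q - (x + 1) by omega, Nat.cast_sub (by omega)]
    push_cast
    rw [sub_sub_cancel, abs_of_nonneg (by positivity)]
  · rw [← Finset.prod_range_add_one_eq_factorial]
    push_cast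
    refine Finset.prod_congr rfl fun x _ => ?_
    rw [abs_sub_comm, abs_of_nonneg (by linarith [(Nat.cast_nonneg x : (0 : ℝ) ≤ x)])]
    ring

theorem prod_sea_outside {N p q : ℕ} (hq : q < N) :
    ∏ x ∈ (sea N).erase q, |((-1 - p : ℤ) : ℝ) - x| =
      (p + N).factorial / (p.factorial * (p + q + 1)) := by
  have hterm : ∀ x : ℕ, |((-1 - p : ℤ) : ℝ) - ((x : ℤ) : ℝ)| = ((p + 1 + x : ℕ) : ℝ) := by
    intro x
    rw [abs_of_nonpos]
    · push_cast; ring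
    · push_cast
      linarith [(Nat.cast_nonneg x : (0 : ℝ) ≤ x), (Nat.cast_nonneg p : (0 : ℝ) ≤ p)]
  rw [prod_sea_erase N q (fun x => |((-1 - p : ℤ) : ℝ) - x|)]
  simp only [hterm]
  have h1 : (p + N).factorial = p.factorial * ∏ x ∈ Finset.range N, (p + 1 + x) := by
    rw [← Nat.ascFactorial_eq_prod_range, Nat.factorial_mul_ascFactorial]
  rw [← Finset.mul_prod_erase _ _ (Finset.mem_range.mpr hq)] at h1
  rw [h1, eq_div_iff (by positivity)]
  push_cast
  ring

theorem prod_ratio_bound {L S : Finset ℤ} {a : ℤ} (haL : a ∈ L) (haS : a ∈ S) {K : ℕ}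
    (h1 : (L \ S).card ≤ K) (h2 : (S \ L).card ≤ K) {f g : ℤ → ℝ}
    (hf : ∀ x ∈ (L ∪ S).erase a, 0 ≤ f x) (hg : ∀ x ∈ (L ∪ S).erase a, 0 ≤ g x)
    (hE : ∀ x ∈ L \ S, g x ≤ 9 * f x) (hH : ∀ x ∈ S \ L, f x ≤ 9 * g x)
    {A B : ℝ} (hA : 0 ≤ A) (hB : 0 ≤ B)
    (h : A * ∏ x ∈ S.erase a, g x ≤ B * ∏ x ∈ S.erase a, f x)
    (hgS : ∀ x ∈ S \ L, 0 < g x) :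
    A * ∏ x ∈ L.erase a, g x ≤ 9 ^ (2 * K) * B * ∏ x ∈ L.erase a, f x := by
  have hL : L.erase a = (L ∩ S).erase a ∪ (L \ S) := by
    ext x
    simp only [Finset.mem_erase, Finset.mem_union, Finset.mem_inter, Finset.mem_sdiff]
    by_cases hx : x = a
    · subst hx; simp [haS]
    · tauto
  have hS : S.erase a = (L ∩ S).erase a ∪ (S \ L) := by
    ext x
    simp only [Finset.mem_erase, Finset.mem_union, Finset.mem_inter, Finset.mem_sdiff]
    by_cases hx : x = a
    · subst hx; simp [haL]
    · tauto
  have dL : Disjoint ((L ∩ S).erase a) (L \ S) := by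
    rw [Finset.disjoint_left]
    intro x hx hx'
    simp only [Finset.mem_erase, Finset.mem_inter, Finset.mem_sdiff] at hx hx'
    tauto
  have dS : Disjoint ((L ∩ S).erase a) (S \ L) := by
    rw [Finset.disjoint_left]
    intro x hx hx'
    simp only [Finset.mem_erase, Finset.mem_inter, Finset.mem_sdiff] at hx hx'
    tauto
  rw [hS, Finset.prod_union dS, Finset.prod_union dS] at h
  rw [hL, Finset.prod_union dL, Finset.prod_union dL]
  have mE : ∀ x ∈ L \ S, x ∈ (L ∪ S).erase a := by
    intro x hx
    simp only [Finset.mem_erase, Finset.mem_union, Finset.mem_sdiff] at hx ⊢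
    exact ⟨fun e => hx.2 (e ▸ haS), Or.inl hx.1⟩
  have mH : ∀ x ∈ S \ L, x ∈ (L ∪ S).erase a := by
    intro x hx
    simp only [Finset.mem_erase, Finset.mem_union, Finset.mem_sdiff] at hx ⊢
    exact ⟨fun e => hx.2 (e ▸ haL), Or.inr hx.1⟩
  have mC : ∀ x ∈ (L ∩ S).erase a, x ∈ (L ∪ S).erase a := by
    intro x hx
    simp only [Finset.mem_erase, Finset.mem_union, Finset.mem_inter] at hx ⊢
    tauto
  have pow_le : ∀ n, n ≤ K → (9 : ℝ) ^ n ≤ 9 ^ K := fun n hn => pow_le_pow_right₀ (by norm_num) hn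
  set Cf := ∏ x ∈ (L ∩ S).erase a, f x
  set Cg := ∏ x ∈ (L ∩ S).erase a, g x
  have hCf : 0 ≤ Cf := Finset.prod_nonneg fun x hx => hf x (mC x hx)
  have hCg : 0 ≤ Cg := Finset.prod_nonneg fun x hx => hg x (mC x hx)
  have bE : ∏ x ∈ L \ S, g x ≤ 9 ^ K * ∏ x ∈ L \ S, f x := by
    calc ∏ x ∈ L \ S, g x ≤ ∏ x ∈ L \ S, (9 * f x) :=
          Finset.prod_le_prod (fun x hx => hg x (mE x hx)) hE
      _ = 9 ^ (L \ S).card * ∏ x ∈ L \ S, f x := by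
          rw [Finset.prod_mul_distrib, Finset.prod_const]
      _ ≤ _ := mul_le_mul_of_nonneg_right (pow_le _ h1)
          (Finset.prod_nonneg fun x hx => hf x (mE x hx))
  have bH : ∏ x ∈ S \ L, f x ≤ 9 ^ K * ∏ x ∈ S \ L, g x := by
    calc ∏ x ∈ S \ L, f x ≤ ∏ x ∈ S \ L, (9 * g x) :=
          Finset.prod_le_prod (fun x hx => hf x (mH x hx)) hH
      _ = 9 ^ (S \ L).card * ∏ x ∈ S \ L, g x := by
          rw [Finset.prod_mul_distrib, Finset.prod_const]
      _ ≤ _ := mul_le_mul_of_nonneg_right (pow_le _ h2)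
          (Finset.prod_nonneg fun x hx => hg x (mH x hx))
  have pH : 0 < ∏ x ∈ S \ L, g x := Finset.prod_pos hgS
  have hEf : 0 ≤ ∏ x ∈ L \ S, f x := Finset.prod_nonneg fun x hx => hf x (mE x hx)
  have key : A * Cg ≤ B * Cf * 9 ^ K := by
    refine le_of_mul_le_mul_right ?_ pH
    calc A * Cg * ∏ x ∈ S \ L, g x = A * (Cg * ∏ x ∈ S \ L, g x) := by ring
      _ ≤ B * (Cf * ∏ x ∈ S \ L, f x) := h
      _ ≤ B * (Cf * (9 ^ K * ∏ x ∈ S \ L, g x)) := by gcongr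
      _ = _ := by ring
  calc A * (Cg * ∏ x ∈ L \ S, g x) ≤ A * (Cg * (9 ^ K * ∏ x ∈ L \ S, f x)) := by gcongr
    _ = (A * Cg) * (9 ^ K * ∏ x ∈ L \ S, f x) := by ring
    _ ≤ (B * Cf * 9 ^ K) * (9 ^ K * ∏ x ∈ L \ S, f x) := by gcongr
    _ = _ := by ring

/-- The scale `R` contains no defect of the configuration `L`. -/
def CleanScale (N : ℕ) (L : Finset ℤ) (R : ℕ) : Prop :=
  (∀ e ∈ L \ sea N, 2 * (e + 1).natAbs < R ∨ 4 * R ≤ (e + 1).natAbs) ∧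
    ∀ h ∈ sea N \ L, 2 * h.natAbs < R ∨ 4 * R ≤ h.natAbs

theorem CleanScale.mem_left {N R : ℕ} {L : Finset ℤ} (h : CleanScale N L R) {q : ℕ}
    (hN : 8 * R ≤ N) (h1 : R ≤ q) (h2 : q < 2 * R) : (q : ℤ) ∈ L := by
  by_contra hq
  have hmem : (q : ℤ) ∈ sea N \ L := by
    rw [Finset.mem_sdiff, sea, Finset.mem_Ico]
    exact ⟨⟨by omega, by omega⟩, hq⟩
  have := h.2 _ hmem
  omega

theorem CleanScale.notMem_right {N R : ℕ} {L : Finset ℤ} (h : CleanScale N L R) {p : ℕ}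
    (h1 : R ≤ p) (h2 : p < 2 * R) : (-1 - p : ℤ) ∉ L := by
  intro hp
  have hmem : (-1 - p : ℤ) ∈ L \ sea N := by
    rw [Finset.mem_sdiff, sea, Finset.mem_Ico]
    exact ⟨hp, by omega⟩
  have := h.1 _ hmem
  omega

theorem configWeight_move_of_clean {z w : ℂ} (hz : ∀ n : ℤ, z ≠ n) (hw : ∀ n : ℤ, w ≠ n) (K : ℕ) :
    ∃ δ : ℝ, 0 < δ ∧ ∀ (N R p q : ℕ) (L : Finset ℤ), 1 ≤ R → 8 * R ≤ N →
      R ≤ p → p < 2 * R → R ≤ q → q < 2 * R → (L \ sea N).card ≤ K → (sea N \ L).card ≤ K →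
      CleanScale N L R →
      δ / (R : ℝ) ^ 2 * configWeight (particleWeight z w N) L ≤
        configWeight (particleWeight z w N) (move L q (-1 - p)) := by
  obtain ⟨c, hc, H⟩ := particleWeight_ratio hz hw
  refine ⟨(c / 9 ^ (2 * K)) ^ 2, by positivity, ?_⟩
  intro N R p q L hR hN hp1 hp2 hq1 hq2 hK1 hK2 hclean
  have haL := hclean.mem_left hN hq1 hq2
  have hbL := hclean.notMem_right hp1 hp2
  have haS : (q : ℤ) ∈ sea N := by rw [sea, Finset.mem_Ico]; omega
  have hqN : q < N := by omega
  have hR' : (0 : ℝ) < R := by exact_mod_cast hR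
  refine configWeight_move (fun x => particleWeight_nonneg z w N x) haL hbL ?_
  have h0 := H N R p q hR hN hp1 hp2 hq1 hq2
  rw [← prod_sea_inside hqN, ← prod_sea_outside hqN] at h0
  have hint : ∀ x : ℤ, |(x : ℝ)| = (x.natAbs : ℝ) := by
    intro x
    rw [Nat.cast_natAbs, Int.cast_abs]
  have ha : ∀ x : ℤ, |((q : ℤ) : ℝ) - x| = (((q : ℤ) - x).natAbs : ℝ) := fun x => by
    rw [← hint]; push_cast; rfl
  have hb : ∀ x : ℤ, |((-1 - p : ℤ) : ℝ) - x| = (((-1 - p : ℤ) - x).natAbs : ℝ) := fun x => by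
    rw [← hint]; push_cast; rfl
  have h3 := prod_ratio_bound haL haS hK1 hK2
    (f := fun x => |((-1 - p : ℤ) : ℝ) - x|) (g := fun x => |((q : ℤ) : ℝ) - x|)
    (fun x _ => abs_nonneg _) (fun x _ => abs_nonneg _)
    (fun x hx => by
      simp only [ha, hb]
      have := hclean.1 x hx
      exact_mod_cast (show ((q : ℤ) - x).natAbs ≤ 9 * ((-1 - p : ℤ) - x).natAbs by omega))
    (fun x hx => by
      simp only [ha, hb]
      have := hclean.2 x hx
      exact_mod_cast (show ((-1 - p : ℤ) - x).natAbs ≤ 9 * ((q : ℤ) - x).natAbs by omega))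
    (by positivity) (norm_nonneg _) h0
    (fun x hx => by
      simp only [ha]
      have := hclean.2 x hx
      exact_mod_cast (show 0 < ((q : ℤ) - x).natAbs by omega))
  set Ua := ‖1 / (Complex.Gamma (z + 1 + (q : ℤ)) * Complex.Gamma (w + N - (q : ℤ)))‖ with hUa
  set Ub := ‖1 / (Complex.Gamma (z + 1 + (-1 - p : ℤ)) * Complex.Gamma (w + N - (-1 - p : ℤ)))‖
    with hUb
  have hpa : particleWeight z w N q = Ua ^ 2 := rfl
  have hpb : particleWeight z w N (-1 - p) = Ub ^ 2 := rfl
  rw [hpa, hpb, ← mul_pow, ← mul_pow, ← div_pow, ← mul_pow]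
  have hprod : 0 ≤ ∏ x ∈ L.erase (q : ℤ), |((q : ℤ) : ℝ) - x| :=
    Finset.prod_nonneg fun _ _ => abs_nonneg _
  refine pow_le_pow_left₀ (by positivity) ?_ 2
  have h9 : (0 : ℝ) < 9 ^ (2 * K) := by positivity
  refine le_of_mul_le_mul_left ?_ h9
  calc 9 ^ (2 * K) * (c / 9 ^ (2 * K) / R * (Ua * ∏ x ∈ L.erase (q : ℤ), |((q : ℤ) : ℝ) - x|))
      = c / R * Ua * ∏ x ∈ L.erase (q : ℤ), |((q : ℤ) : ℝ) - x| := by field_simp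
    _ ≤ _ := h3
    _ = _ := by ring

open Classical in
theorem card_clean_scales {N K : ℕ} {L : Finset ℤ} (h1 : (L \ sea N).card ≤ K)
    (h2 : (sea N \ L).card ≤ K) (J : ℕ) :
    J ≤ ((Finset.range J).filter fun j => CleanScale N L (8 ^ j)).card + 2 * K := by
  let B : Finset ℕ := (L \ sea N).image (fun e => Nat.log 8 (2 * (e + 1).natAbs)) ∪
    (sea N \ L).image (fun h => Nat.log 8 (2 * h.natAbs))
  have hB : B.card ≤ 2 * K := by
    refine (Finset.card_union_le _ _).trans ?_
    have := (Finset.card_image_le (s := L \ sea N) (f := fun e => Nat.log 8 (2 * (e + 1).natAbs)))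
    have := (Finset.card_image_le (s := sea N \ L) (f := fun h => Nat.log 8 (2 * h.natAbs)))
    omega
  have hlog : ∀ j t : ℕ, ¬ (2 * t < 8 ^ j ∨ 4 * 8 ^ j ≤ t) → Nat.log 8 (2 * t) = j := by
    intro j t h
    refine Nat.log_eq_of_pow_le_of_lt_pow (by omega) ?_
    rw [pow_succ]; omega
  have hsub : Finset.range J ⊆ ((Finset.range J).filter fun j => CleanScale N L (8 ^ j)) ∪ B := by
    intro j hj
    rw [Finset.mem_union, Finset.mem_filter]
    by_cases hcl : CleanScale N L (8 ^ j)
    · exact Or.inl ⟨hj, hcl⟩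
    · right
      rw [CleanScale, not_and_or] at hcl
      rw [Finset.mem_union, Finset.mem_image, Finset.mem_image]
      rcases hcl with h | h
      · push Not at h
        obtain ⟨e, he, h⟩ := h
        exact Or.inl ⟨e, he, hlog j _ (by omega)⟩
      · push Not at h
        obtain ⟨e, he, h⟩ := h
        exact Or.inr ⟨e, he, hlog j _ (by omega)⟩
  have := (Finset.card_le_card hsub).trans (Finset.card_union_le _ _)
  rw [Finset.card_range] at this
  omega

/-- The moves between positions of scale `R`. -/
def block (R : ℕ) : Finset (ℤ × ℤ) :=
  (Finset.Ico R (2 * R) ×ˢ Finset.Ico R (2 * R)).image fun x : ℕ × ℕ => ((x.1 : ℤ), (-1 - x.2 : ℤ))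

theorem card_block (R : ℕ) : (block R).card = R ^ 2 := by
  rw [block, Finset.card_image_of_injective, Finset.card_product, Nat.card_Ico]
  · rw [show 2 * R - R = R by omega, sq]
  · rintro ⟨a, b⟩ ⟨c, d⟩ h
    simp only [Prod.mk.injEq] at h
    exact Prod.ext (by simp only; omega) (by simp only; omega)

theorem mem_block {R : ℕ} {x : ℤ × ℤ} (hx : x ∈ block R) : ∃ q p : ℕ, R ≤ p ∧ p < 2 * R ∧
    R ≤ q ∧ q < 2 * R ∧ x = ((q : ℤ), (-1 - p : ℤ)) := by
  rw [block, Finset.mem_image] at hx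
  obtain ⟨⟨q, p⟩, h, rfl⟩ := hx
  rw [Finset.mem_product, Finset.mem_Ico, Finset.mem_Ico] at h
  exact ⟨q, p, h.2.1, h.2.2, h.1.1, h.1.2, rfl⟩

open Classical in
theorem sum_moves_lower_bound {z w : ℂ} (hz : ∀ n : ℤ, z ≠ n) (hw : ∀ n : ℤ, w ≠ n) (K : ℕ) :
    ∃ δ : ℝ, 0 < δ ∧ ∀ (N J m : ℕ) (L : Finset ℤ), 8 ^ J ≤ N → m + 2 * K ≤ J →
      (L \ sea N).card ≤ K → (sea N \ L).card ≤ K →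
      m * δ * configWeight (particleWeight z w N) L ≤
        ∑ x ∈ sea N ×ˢ Finset.Ico (-N : ℤ) 0 with x.1 ∈ L ∧ x.2 ∉ L,
          configWeight (particleWeight z w N) (move L x.1 x.2) := by
  obtain ⟨δ, hδ, H⟩ := configWeight_move_of_clean hz hw K
  refine ⟨δ, hδ, fun N J m L hN hm hK1 hK2 => ?_⟩
  set T := (Finset.range J).filter fun j => CleanScale N L (8 ^ j)
  have hT : m ≤ T.card := by
    have : J ≤ T.card + 2 * K := card_clean_scales hK1 hK2 J
    omega
  have hnn : ∀ L', 0 ≤ configWeight (particleWeight z w N) L' := fun L' =>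
    configWeight_nonneg (fun x => particleWeight_nonneg z w N x) L'
  have hfit : ∀ j ∈ T, 8 * 8 ^ j ≤ N := by
    intro j hj
    have hj' := Finset.mem_range.mp (Finset.mem_filter.mp hj).1
    calc 8 * 8 ^ j = 8 ^ (j + 1) := by ring
      _ ≤ 8 ^ J := Nat.pow_le_pow_right (by norm_num) hj'
      _ ≤ N := hN
  have hsub : T.biUnion (fun j => block (8 ^ j)) ⊆
      {x ∈ sea N ×ˢ Finset.Ico (-N : ℤ) 0 | x.1 ∈ L ∧ x.2 ∉ L} := by
    intro x hx
    rw [Finset.mem_biUnion] at hx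
    obtain ⟨j, hj, hx⟩ := hx
    obtain ⟨q, p, hp1, hp2, hq1, hq2, rfl⟩ := mem_block hx
    have hcl := (Finset.mem_filter.mp hj).2
    have hf := hfit j hj
    rw [Finset.mem_filter, Finset.mem_product, sea, Finset.mem_Ico, Finset.mem_Ico]
    refine ⟨⟨⟨?_, ?_⟩, ?_, ?_⟩, hcl.mem_left hf hq1 hq2, hcl.notMem_right hp1 hp2⟩ <;>
      simp only <;> omega
  have hdisj : (T : Set ℕ).PairwiseDisjoint fun j => block (8 ^ j) := by
    intro i _ j _ hij
    rw [Function.onFun, Finset.disjoint_left]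
    intro x hx hx'
    obtain ⟨q, p, -, -, hq1, hq2, rfl⟩ := mem_block hx
    obtain ⟨q', p', -, -, hq1', hq2', h⟩ := mem_block hx'
    have hq : q = q' := by
      have := congrArg Prod.fst h
      simpa using this
    subst hq
    refine hij ?_
    have e1 : Nat.log 8 q = i := Nat.log_eq_of_pow_le_of_lt_pow hq1 (by rw [pow_succ]; omega)
    have e2 : Nat.log 8 q = j := Nat.log_eq_of_pow_le_of_lt_pow hq1' (by rw [pow_succ]; omega)
    omega
  refine le_trans ?_ (Finset.sum_le_sum_of_subset_of_nonneg hsub fun x _ _ => hnn _)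
  rw [Finset.sum_biUnion hdisj]
  calc (m : ℝ) * δ * configWeight (particleWeight z w N) L
      ≤ T.card * δ * configWeight (particleWeight z w N) L := by
        have := hnn L
        gcongr
    _ = ∑ j ∈ T, δ * configWeight (particleWeight z w N) L := by
        rw [Finset.sum_const, nsmul_eq_mul, mul_assoc]
    _ ≤ _ := by
        refine Finset.sum_le_sum fun j hj => ?_
        have hR : 1 ≤ 8 ^ j := Nat.one_le_pow _ _ (by norm_num)
        have hR' : (0 : ℝ) < ((8 ^ j : ℕ) : ℝ) := by exact_mod_cast hR
        calc δ * configWeight (particleWeight z w N) L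
            = ∑ x ∈ block (8 ^ j), δ / ((8 ^ j : ℕ) : ℝ) ^ 2 *
                configWeight (particleWeight z w N) L := by
              rw [Finset.sum_const, card_block, nsmul_eq_mul, Nat.cast_pow (8 ^ j) 2]
              field_simp
          _ ≤ _ := by
              refine Finset.sum_le_sum fun x hx => ?_
              obtain ⟨q, p, hp1, hp2, hq1, hq2, rfl⟩ := mem_block hx
              exact H N _ p q L hR (hfit j hj) hp1 hp2 hq1 hq2 hK1 hK2 (Finset.mem_filter.mp hj).2

/-! ### Thick hooks -/

/-- Signatures with at most `K` particles outside the sea. -/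
def fewDefects (K N : ℕ) : Set (Signature N) := {s | (config s \ sea N).card ≤ K}

theorem tsum_fewDefects_le {z w : ℂ} (hz : ∀ n : ℤ, z ≠ n) (hw : ∀ n : ℤ, w ≠ n) (K : ℕ) :
    ∃ δ : ℝ, 0 < δ ∧ ∀ m : ℕ, ∃ N : ℕ, ENNReal.ofReal (m * δ) *
      ∑' s : fewDefects K N, weight z w s.1 ≤ (K + 1) ^ 2 * normalization z w N := by
  classical
  obtain ⟨δ, hδ, H⟩ := sum_moves_lower_bound hz hw K
  refine ⟨δ, hδ, fun m => ⟨8 ^ (m + 2 * K), ?_⟩⟩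
  generalize hN : 8 ^ (m + 2 * K) = N
  set g : Finset ℤ → ℝ≥0∞ := fun L => ENNReal.ofReal (configWeight (particleWeight z w N) L)
    with hg
  let G : Finset ℤ → ℝ≥0∞ := Set.indicator {L | L.card = N} g
  let A : Set (Finset ℤ) := {L | L.card = N ∧ (L \ sea N).card ≤ K}
  have hsea : (sea N).card = N := by simp [sea]
  have hA : ∀ L ∈ A, (L \ sea N).card ≤ K ∧ (sea N \ L).card ≤ K := by
    rintro L ⟨h1, h2⟩
    refine ⟨h2, ?_⟩
    rwa [← Finset.card_sdiff_comm (h1.trans hsea.symm)]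
  have hmain := counting_moves G (sea N) (sea N ×ˢ Finset.Ico (-N : ℤ) 0)
    (fun p hp => by
      rw [Finset.mem_product, Finset.mem_Ico] at hp
      refine ⟨hp.1, fun h => ?_⟩
      rw [sea, Finset.mem_Ico] at h
      omega) K A hA (ENNReal.ofReal (m * δ))
    (fun L hL => by
      have hG : G L = g L := Set.indicator_of_mem (s := {L : Finset ℤ | L.card = N}) hL.1 g
      have h := H N (m + 2 * K) m L hN.le le_rfl (hA L hL).1 (hA L hL).2
      rw [hG, hg, ← ENNReal.ofReal_mul (by positivity)]
      refine (ENNReal.ofReal_le_ofReal h).trans ?_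
      rw [ENNReal.ofReal_sum_of_nonneg fun x _ =>
        configWeight_nonneg (fun y => particleWeight_nonneg z w N y) _]
      refine le_of_eq (Finset.sum_congr ?_ fun x hx => ?_)
      · congr!
      · have hx' := (Finset.mem_filter.mp hx).2
        have hc : (move L x.1 x.2).card = N := (card_move hx'.1 hx'.2).trans hL.1
        exact (Set.indicator_of_mem (s := {L : Finset ℤ | L.card = N}) hc g).symm)
  have hGconf : ∀ s : Signature N, G (config s) = g (config s) := fun s =>
    Set.indicator_of_mem (s := {L : Finset ℤ | L.card = N}) (card_config s) g
  have hT : ∑' L, G L = ∑' s : Signature N, g (config s) := by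
    rw [← config_injective.tsum_eq (f := G)]
    · exact tsum_congr hGconf
    · intro L hL
      have : L.card = N := by
        by_contra h
        exact hL (Set.indicator_of_notMem (s := {L : Finset ℤ | L.card = N}) h g)
      exact exists_config this
  have hTA : ∑' s : fewDefects K N, g (config s.1) ≤ ∑' L : A, G L := by
    let φ : fewDefects K N → A := fun s => ⟨config s.1, card_config s.1, s.2⟩
    have hφ : Function.Injective φ := fun s t h =>
      Subtype.ext (config_injective (Subtype.ext_iff.mp h))
    refine le_trans (le_of_eq ?_) (ENNReal.tsum_comp_le_tsum_of_injective hφ fun L : A => G L)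
    exact tsum_congr fun s => (hGconf s.1).symm
  rw [hT] at hmain
  simp only [normalization, weight_eq_configWeight, ENNReal.tsum_mul_left]
  rw [mul_left_comm, mul_left_comm ((K + 1 : ℝ≥0∞) ^ 2)]
  exact mul_le_mul_right ((mul_le_mul_right hTA _).trans hmain) _

theorem mem_fewDefects {N k : ℕ} (s : Signature N) (h1 : (k, k) ∉ s.posDiagram)
    (h2 : (k, k) ∉ s.negDiagram) : s ∈ fewDefects (2 * k) N := by
  have p1 : ∀ i : Fin N, posn s i < 0 → (i : ℕ) < k := by
    intro i hi
    by_contra h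
    refine h1 ((Signature.mem_posDiagram s k k).mpr ⟨by omega, ?_⟩)
    have hle : (⟨k, by omega⟩ : Fin N) ≤ i := by rw [Fin.le_def]; simp; omega
    have := s.2 hle
    simp only [posn] at hi
    omega
  have p2 : ∀ i : Fin N, (N : ℤ) ≤ posn s i → N < (i : ℕ) + 1 + k := by
    intro i hi
    by_contra h
    refine h2 ((Signature.mem_posDiagram s.dual k k).mpr ⟨by omega, ?_⟩)
    have hle : i ≤ (⟨k, by omega⟩ : Fin N).rev := by rw [Fin.le_def]; simp; omega
    have := s.2 hle
    simp only [posn] at hi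
    simp only [Signature.dual]
    omega
  have hsub : config s \ sea N ⊆
      (Finset.univ.filter fun i : Fin N => (i : ℕ) < k ∨ N < (i : ℕ) + 1 + k).image (posn s) := by
    intro x hx
    rw [Finset.mem_sdiff, config, Finset.mem_image, sea, Finset.mem_Ico] at hx
    obtain ⟨⟨i, -, rfl⟩, hx⟩ := hx
    refine Finset.mem_image_of_mem _ (Finset.mem_filter.mpr ⟨Finset.mem_univ i, ?_⟩)
    rcases lt_or_ge (posn s i) 0 with h | h
    · exact Or.inl (p1 i h)
    · exact Or.inr (p2 i (by omega))
  have hcard : (Finset.univ.filter fun i : Fin N => (i : ℕ) < k ∨ N < (i : ℕ) + 1 + k).card ≤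
      2 * k := by
    have h := Finset.card_le_card_of_injOn (s := Finset.univ.filter fun i : Fin N =>
      (i : ℕ) < k ∨ N < (i : ℕ) + 1 + k) (t := Finset.range k ∪ Finset.Ico (N - k) N)
      (fun i : Fin N => (i : ℕ)) (by
        intro i hi
        have hi' := (Finset.mem_filter.mp hi).2
        have := i.2
        simp only [Finset.coe_union, Finset.coe_range, Finset.coe_Ico, Set.mem_union, Set.mem_Iio,
          Set.mem_Ico]
        omega) (fun i _ j _ h => Fin.ext h)
    refine h.trans ((Finset.card_union_le _ _).trans ?_)
    rw [Finset.card_range, Nat.card_Ico]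
    omega
  exact (Finset.card_le_card hsub).trans (Finset.card_image_le.trans hcard)

theorem measure_endpoint_le {z w : ℂ} {ρ : Measure GTPath} (hρ : IsZWMeasure z w ρ) {N : ℕ}
    (s : Signature N) : ρ {t | t.1 N = s} ≤ coherentSystem z w s := by
  have := Fintype.ofFinite {τ : FinPath N // τ.endpoint = s}
  have hsub : {t : GTPath | t.1 N = s} ⊆
      ⋃ τ : {τ : FinPath N // τ.endpoint = s}, cylinder τ.1 := by
    intro t ht
    rw [Set.mem_iUnion]
    exact ⟨⟨⟨fun k _ => t.1 k, fun k _ => t.2 k⟩, ht⟩, fun k _ => rfl⟩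
  refine (measure_mono hsub).trans ((measure_iUnion_le _).trans (le_of_eq ?_))
  have h : ∀ τ : {τ : FinPath N // τ.endpoint = s},
      ρ (cylinder τ.1) = coherentSystem z w s / (dim s : ℝ≥0∞) := by
    rintro ⟨τ, rfl⟩
    exact hρ.apply_cylinder N τ
  have hd : (dim s : ℝ≥0∞) ≠ 0 := by exact_mod_cast (dim_pos s).ne'
  simp only [h]
  rw [tsum_fintype, Finset.sum_const, nsmul_eq_mul, Finset.card_univ, ← Nat.card_eq_fintype_card]
  exact ENNReal.mul_div_cancel hd (ENNReal.natCast_ne_top _)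

theorem measure_fewDefects_le {z w : ℂ} {ρ : Measure GTPath} (hρ : IsZWMeasure z w ρ) (K N : ℕ) :
    ρ {t | t.1 N ∈ fewDefects K N} ≤
      (normalization z w N)⁻¹ * ∑' s : fewDefects K N, weight z w s.1 := by
  have hsub : {t : GTPath | t.1 N ∈ fewDefects K N} ⊆
      ⋃ s : fewDefects K N, {t : GTPath | t.1 N = s.1} := by
    intro t ht
    rw [Set.mem_iUnion]
    exact ⟨⟨t.1 N, ht⟩, rfl⟩
  refine (measure_mono hsub).trans ((measure_iUnion_le _).trans ?_)
  rw [← ENNReal.tsum_mul_left]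
  exact ENNReal.tsum_le_tsum fun s => measure_endpoint_le hρ s.1

theorem measure_forall_fewDefects {z w : ℂ} (hz : ∀ n : ℤ, z ≠ n) (hw : ∀ n : ℤ, w ≠ n)
    {ρ : Measure GTPath} (hρ : IsZWMeasure z w ρ) (K : ℕ) :
    ρ {t | ∀ N, t.1 N ∈ fewDefects K N} = 0 := by
  have := hρ.isProbabilityMeasure
  obtain ⟨δ, hδ, H⟩ := tsum_fewDefects_le hz hw K
  have hbound : ∀ m : ℕ, ENNReal.ofReal (m * δ) * ρ {t | ∀ N, t.1 N ∈ fewDefects K N} ≤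
      (K + 1) ^ 2 := by
    intro m
    obtain ⟨N, hN⟩ := H m
    have h1 : ρ {t | ∀ N, t.1 N ∈ fewDefects K N} ≤ ρ {t | t.1 N ∈ fewDefects K N} :=
      measure_mono fun t ht => ht N
    calc ENNReal.ofReal (m * δ) * ρ {t | ∀ N, t.1 N ∈ fewDefects K N}
        ≤ ENNReal.ofReal (m * δ) *
            ((normalization z w N)⁻¹ * ∑' s : fewDefects K N, weight z w s.1) :=
          mul_le_mul_right (h1.trans (measure_fewDefects_le hρ K N)) _
      _ = (normalization z w N)⁻¹ *
            (ENNReal.ofReal (m * δ) * ∑' s : fewDefects K N, weight z w s.1) := mul_left_comm _ _ _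
      _ ≤ (normalization z w N)⁻¹ * ((K + 1) ^ 2 * normalization z w N) := mul_le_mul_right hN _
      _ = (K + 1) ^ 2 * ((normalization z w N)⁻¹ * normalization z w N) := mul_left_comm _ _ _
      _ ≤ (K + 1) ^ 2 * 1 := mul_le_mul_right (ENNReal.inv_mul_le_one _) _
      _ = (K + 1) ^ 2 := mul_one _
  set x := ρ {t | ∀ N, t.1 N ∈ fewDefects K N} with hx
  have hxt : x ≠ ⊤ := measure_ne_top _ _
  by_contra h0
  have hpos : 0 < x.toReal := ENNReal.toReal_pos h0 hxt
  obtain ⟨m, hm⟩ := exists_nat_gt (((K : ℝ) + 1) ^ 2 / (δ * x.toReal))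
  rw [div_lt_iff₀ (by positivity)] at hm
  have h := hbound m
  rw [← ENNReal.ofReal_toReal hxt, ← ENNReal.ofReal_mul (by positivity)] at h
  have e : ((K : ℝ≥0∞) + 1) ^ 2 = ENNReal.ofReal (((K : ℝ) + 1) ^ 2) := by
    rw [ENNReal.ofReal_pow (by positivity), ENNReal.ofReal_add (by positivity) (by norm_num)]
    simp
  rw [e, ENNReal.ofReal_le_ofReal_iff (by positivity)] at h
  linarith

theorem measure_thickHookPaths {z w : ℂ} (hz : ∀ n : ℤ, z ≠ n) (hw : ∀ n : ℤ, w ≠ n)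
    {ρ : Measure GTPath} (hρ : IsZWMeasure z w ρ) : ρ thickHookPaths = 0 := by
  have hsub : thickHookPaths ⊆ ⋃ k : ℕ, {t : GTPath | ∀ N, t.1 N ∈ fewDefects (2 * k) N} := by
    intro t ht
    rw [mem_thickHookPaths, Set.ne_univ_iff_exists_notMem, Set.ne_univ_iff_exists_notMem] at ht
    obtain ⟨⟨⟨a, b⟩, h1⟩, ⟨⟨c, d⟩, h2⟩⟩ := ht
    simp only [GTPath.posUnion, GTPath.negUnion, Set.mem_iUnion, not_exists, SetLike.mem_coe]
      at h1 h2
    rw [Set.mem_iUnion]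
    refine ⟨max (max a b) (max c d), fun N => mem_fewDefects _ (fun h => h1 N ?_) fun h => h2 N ?_⟩
    · exact (t.1 N).posDiagram.up_left_mem (by omega) (by omega) h
    · exact (t.1 N).negDiagram.up_left_mem (by omega) (by omega) h
  exact measure_mono_null hsub (measure_iUnion_null fun k =>
    measure_forall_fewDefects hz hw hρ (2 * k))

end GelfandTsetlin

theorem theorem10 (z w : ℂ) (hz : ∀ n : ℤ, z ≠ (n : ℂ)) (hw : ∀ n : ℤ, w ≠ (n : ℂ))
    (hzw : -(1 / 2 : ℝ) < (z + w).re) :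
    (∃! ρ : MeasureTheory.Measure GelfandTsetlin.GTPath, GelfandTsetlin.IsZWMeasure z w ρ) ∧
      ∀ ρ : MeasureTheory.Measure GelfandTsetlin.GTPath, GelfandTsetlin.IsZWMeasure z w ρ →
        ρ GelfandTsetlin.thickHookPaths = 0 :=
  ⟨GelfandTsetlin.existsUnique_zwMeasure hz hw hzw,
    fun _ hρ => GelfandTsetlin.measure_thickHookPaths hz hw hρ⟩
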